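/- Let $X_1,\dots,X_n$ be independent random variables with values in a measurable space $\mathcal X$, let $F:\mathcal X^n\to\mathbb R$ be measurable, and let $Z=F(X_1,\dots,X_n)$ be integrable. Let $X_1',\dots,X_n'$ be independent copies of $X_1,\dots,X_n$ (that is, $X_i'$ has the law of $X_i$ and $X_1,\dots,X_n,X_1',\dots,X_n'$ are independent), and put $$Z_i'=F(X_1,\dots,X_{i-1},X_i',X_{i+1},\dots,X_n),\qquad V^+=\mathbb E\Big[\sum_{i=1}^n (Z-Z_i')_+^2\,\Big|\,X_1,\dots,X_n\Big].$$ For arbitrary measurable functions $F_i:\mathcal X^{n-1}\to\mathbb R$ put $$Z_i=F_i(X_1,\dots,X_{i-1},X_{i+1},\dots,X_n),\qquad V=\sum_{i=1}^n (Z-Z_i)^2.$$ Write $x_+=\max(x,0)$, $x_-=\max(-x,0)$, $a\vee b=\max(a,b)$ and, for $q>0$, $\|Y\|_q=(\mathbb E|Y|^q)^{1/q}\in[0,\infty]$. There are universal constants $0<C_1<4.16$ and $0<C_2<2.42$ such that the following holds. (1) If $M\ge 0$ is a random variable such that almost surely $(Z-Z_i')_+\le M$ for every $1\le i\le n$, then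 for every real $q\ge 2$ $$\big\|(Z-\mathbb E Z)_-\big\|_q\le\sqrt{C_1\,q\,\big(\|V^+\|_{q/2}\vee q\|M\|_q^2\big)}.$$ (2) If $M\ge 0$ is a random variable such that almost surely $0\le Z-Z_i\le M$ for every $1\le i\le n$, then for every real $q\ge 2$ $$\big\|(Z-\mathbb E Z)_-\big\|_q\le\sqrt{C_2\,q\,\big(\|V\|_{q/2}\vee q\|M\|_q^2\big)}.$$ -/

import Mathlib

open MeasureTheory ProbabilityTheory
open scoped ENNReal

noncomputable section

namespace MomentIneq

variable {Ω 𝒳 : Type*} {n : ℕ}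

/-- `Z = F(X₁, …, Xₙ)`. -/
def Z (F : (Fin n → 𝒳) → ℝ) (X : Fin n → Ω → 𝒳) (ω : Ω) : ℝ :=
  F (fun j => X j ω)

/-- `Z'ᵢ = F(X₁, …, Xᵢ₋₁, X'ᵢ, Xᵢ₊₁, …, Xₙ)`. -/
def Zcopy (F : (Fin n → 𝒳) → ℝ) (X X' : Fin n → Ω → 𝒳) (i : Fin n) (ω : Ω) : ℝ :=
  F (Function.update (fun j => X j ω) i (X' i ω))

/-- `Zᵢ = Fᵢ(X₁, …, Xᵢ₋₁, Xᵢ₊₁, …, Xₙ)`. -/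
def Zloo (G : (i : Fin n) → ({j : Fin n // j ≠ i} → 𝒳) → ℝ) (X : Fin n → Ω → 𝒳)
    (i : Fin n) (ω : Ω) : ℝ :=
  G i (fun j => X j ω)

/-- The σ-algebra on `Ω` generated by the vector `(X₁, …, Xₙ)`. -/
abbrev sigmaX [MeasurableSpace 𝒳] (X : Fin n → Ω → 𝒳) : MeasurableSpace Ω :=
  MeasurableSpace.comap (fun ω j => X j ω) MeasurableSpace.pi

/-- `V⁺ = 𝔼[∑ᵢ (Z - Z'ᵢ)₊² | X₁, …, Xₙ]`. -/
def Vplus [MeasurableSpace Ω] [MeasurableSpace 𝒳] (P : Measure Ω)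
    (F : (Fin n → 𝒳) → ℝ) (X X' : Fin n → Ω → 𝒳) : Ω → ℝ :=
  P[fun ω => ∑ i, ((Z F X ω - Zcopy F X X' i ω)⁺) ^ 2 | sigmaX X]

/-- `V = ∑ᵢ (Z - Zᵢ)²`. -/
def V (F : (Fin n → 𝒳) → ℝ) (G : (i : Fin n) → ({j : Fin n // j ≠ i} → 𝒳) → ℝ)
    (X : Fin n → Ω → 𝒳) (ω : Ω) : ℝ :=
  ∑ i, (Z F X ω - Zloo G X i ω) ^ 2

/-- `‖Y‖_q = (𝔼|Y|^q)^{1/q}` for a positive real `q`, with values in `[0, ∞]`. -/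
def lqNorm [MeasurableSpace Ω] (P : Measure Ω) (q : ℝ) (Y : Ω → ℝ) : ℝ≥0∞ :=
  eLpNorm Y (ENNReal.ofReal q) P

end MomentIneq

end

/-! Write ξ = (Z - EZ)₋, N_q = ‖ξ‖_q and p = q/(q-1), which lies in (1, 2]. For f = ξ^(q-1) the
entropy E f^p - (E f)^p equals N_q^q - N_{q-1}^q (`rnorm_entropy`), so any bound on it is a
recursion in q with step 1. On a product space this entropy is subadditive (`entropy_pi_le`): it is
at most the sum over i of the expected Bregman divergence of x^p between f and a reference not
depending on the i-th coordinate. This rests on the joint convexity of the divergence for 1 < p ≤ 2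
(`breg_tangent`, `breg_integral_le`).

For (2) the references are the powers (Z_i - EZ)₋^(q-1). A second-order bound with factor q/2
(`breg_rpow_le`) and Hölder's inequality give N_q^q ≤ N_{q-1}^q + (q/2) v (N_q + m)^(q-2), where v =
‖V‖_{q/2} and m is the L^q norm of the largest increment.

For (1) the references are conditional means, and exchanging X_i with X_i' leaves only the
resamplings that lower Z (`entropy_le_resample_symm`). The weight then involves (ξ + Y_i)^(q-2) with
Y_i = (Z - Z_i')₊; it depends on X_i' and cannot be pulled out of the conditional expectation
defining V⁺. Given X, however, the Y_i are independent. `decouple` replaces Y_i in the weight by a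
level T(X) that all of them respect with conditional probability at least 4/5, at the cost of 5/4
times (max Y_i)² with its own weight.

Both recursions are solved by `sq_le_of_recursion`. Put R_q = v ∨ q m². If N_q² > C q R_q, then v
and m are small compared with N_q, and the bound at q - 1 gives N_{q-1}^q ≤ (1 - 1/q)^(q/2) N_q^q.
The recursion becomes N_q^q ≤ θ N_q^q with θ < 1, a contradiction. `contraction_copy` and
`contraction_ref` check θ < 1 for C = 4.159 and C = 2.4195.

All this is done for bounded nonnegative functions on a product space. Truncation, which is monotone
and 1-Lipschitz, and Fatou's lemma give the general case (`eLpNorm_negPart_le`). -/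

noncomputable section

namespace MomentIneq

/-! ### Real inequalities -/

/-- Convexity of x^b applied to A + B - 1 = A((1 - 1/A)·1 + (1/A)·B). Together with `le_shift_rpow`
it gives the sign of a derivative in `shift_rpow_le_dual`. -/
lemma shift_rpow_le {A B b : ℝ} (hA : 1 ≤ A) (hB : 0 ≤ B) (hb : 1 ≤ b) :
    (A + B - 1) ^ b ≤ A ^ (b - 1) * (A - 1 + B ^ b) := by
  have hA0 : 0 < A := by linarith
  have h := (convexOn_rpow hb).2 (Set.mem_Ici.2 (zero_le_one (α := ℝ))) (Set.mem_Ici.2 hB)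
    (show 0 ≤ 1 - 1 / A by rw [sub_nonneg, div_le_one hA0]; exact hA) (show 0 ≤ 1 / A by positivity) (by ring)
  simp only [smul_eq_mul, Real.one_rpow, mul_one] at h
  have h1 : (A + B - 1) = A * (1 - 1 / A + 1 / A * B) := by field_simp; ring
  have h2 : 0 ≤ 1 - 1 / A + 1 / A * B := by
    have : 0 ≤ 1 - 1 / A := by rw [sub_nonneg, div_le_one hA0]; exact hA
    positivity
  have h3 : A ^ b = A ^ (b - 1) * A := by rw [Real.rpow_sub_one hA0.ne']; field_simp
  rw [h1, Real.mul_rpow hA0.le h2, h3, mul_assoc]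
  refine mul_le_mul_of_nonneg_left ?_ (by positivity)
  calc A * (1 - 1 / A + 1 / A * B) ^ b ≤ A * (1 - 1 / A + 1 / A * B ^ b) := by gcongr
    _ = _ := by field_simp

/-- For A ≤ 1 it is B that is a convex combination: of (A + B - 1)/A and 1, with weights A and 1 -
A. -/
lemma le_shift_rpow {A B b : ℝ} (hA : 0 < A) (hA1 : A ≤ 1) (hAB : 0 ≤ A + B - 1) (hb : 1 ≤ b) :
    A ^ (b - 1) * (A - 1 + B ^ b) ≤ (A + B - 1) ^ b := by
  have h := (convexOn_rpow hb).2 (Set.mem_Ici.2 (show 0 ≤ (A + B - 1) / A by positivity))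
    (Set.mem_Ici.2 (zero_le_one (α := ℝ))) hA.le (show 0 ≤ 1 - A by linarith) (by ring)
  simp only [smul_eq_mul, Real.one_rpow, mul_one] at h
  rw [show A * ((A + B - 1) / A) + (1 - A) = B by field_simp; ring] at h
  have h3 : A ^ b = A ^ (b - 1) * A := by rw [Real.rpow_sub_one hA.ne']; field_simp
  calc A ^ (b - 1) * (A - 1 + B ^ b) ≤ A ^ (b - 1) * (A * ((A + B - 1) / A) ^ b) := by
        gcongr; linarith
    _ = (A + B - 1) ^ b := by
        rw [Real.div_rpow hAB hA.le, h3]; field_simp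

lemma hasDerivAt_dual {A B b : ℝ} (hb : 1 ≤ b) :
    HasDerivAt (fun A : ℝ => A ^ (b + 1) + B ^ (b + 1) - (1 + 1 / b) * (A ^ b + B ^ b - A ^ b * B ^ b)
      + 1 / b) ((b + 1) * (A ^ (b - 1) * (A - 1 + B ^ b))) A := by
  have hb0 : 0 < b := by linarith
  have h1 : HasDerivAt (fun A : ℝ => A ^ (b + 1)) ((b + 1) * A ^ b) A := by
    simpa using Real.hasDerivAt_rpow_const (x := A) (p := b + 1) (Or.inr (by linarith))
  have h2 : HasDerivAt (fun A : ℝ => A ^ b) (b * A ^ (b - 1)) A :=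
    Real.hasDerivAt_rpow_const (Or.inr hb)
  have h3 := (((h1.add_const (B ^ (b + 1))).sub
    (((h2.add_const (B ^ b)).sub (h2.mul_const (B ^ b))).const_mul (1 + 1 / b))).add_const (1 / b))
  refine h3.congr_deriv ?_
  rcases eq_or_ne A 0 with rfl | hA
  · rcases eq_or_lt_of_le hb with rfl | hb1
    · simp; ring
    · rw [Real.zero_rpow (by linarith), Real.zero_rpow (by linarith)]; ring
  · rw [Real.rpow_sub_one hA]; field_simp; ring

lemma hasDerivAt_shift {A B b : ℝ} (hb : 1 ≤ b) :
    HasDerivAt (fun A : ℝ => (A + B - 1) ^ (b + 1)) ((b + 1) * (A + B - 1) ^ b) A := by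
  have h := (((hasDerivAt_id A).add_const B).sub_const 1).rpow_const (p := b + 1)
    (Or.inr (by linarith))
  simpa using h

lemma dual_at_one (B b : ℝ) :
    (1 : ℝ) ^ (b + 1) + B ^ (b + 1) - (1 + 1 / b) * (1 ^ b + B ^ b - 1 ^ b * B ^ b) + 1 / b
      = (1 + B - 1) ^ (b + 1) := by
  simp

/-- The concave dual inequality behind the joint convexity of the Bregman divergence of `x ^ p`. -/
lemma shift_rpow_le_dual {A B b : ℝ} (hA : 0 ≤ A) (hB : 0 ≤ B) (hb : 1 ≤ b) (hAB : 0 ≤ A + B - 1) :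
    (A + B - 1) ^ (b + 1) ≤
      A ^ (b + 1) + B ^ (b + 1) - (1 + 1 / b) * (A ^ b + B ^ b - A ^ b * B ^ b) + 1 / b := by
  have hd : ∀ A : ℝ, HasDerivAt (fun A : ℝ => (A ^ (b + 1) + B ^ (b + 1)
      - (1 + 1 / b) * (A ^ b + B ^ b - A ^ b * B ^ b) + 1 / b) - (A + B - 1) ^ (b + 1))
      ((b + 1) * (A ^ (b - 1) * (A - 1 + B ^ b)) - (b + 1) * (A + B - 1) ^ b) A := fun A =>
    (hasDerivAt_dual hb).sub (hasDerivAt_shift hb)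
  -- The two sides agree at A = 1 for every B; their difference decreases before A = 1 and increases
  -- after it.
  have hone := dual_at_one B b
  rcases le_total 1 A with h1 | h1
  · have hm := monotoneOn_of_deriv_nonneg (convex_Ici (1 : ℝ))
      (fun x _ => (hd x).continuousAt.continuousWithinAt)
      (fun x _ => (hd x).differentiableAt.differentiableWithinAt) (fun x hx => by
        rw [interior_Ici, Set.mem_Ioi] at hx
        rw [(hd x).deriv, ← mul_sub]
        exact mul_nonneg (by linarith) (sub_nonneg.2 (shift_rpow_le hx.le hB hb)))
    have := hm (Set.self_mem_Ici) h1 h1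
    simp only at this
    linarith
  · have hm := antitoneOn_of_deriv_nonpos (convex_Icc A (1 : ℝ))
      (fun x _ => (hd x).continuousAt.continuousWithinAt)
      (fun x _ => (hd x).differentiableAt.differentiableWithinAt) (fun x hx => by
        rw [interior_Icc, Set.mem_Ioo] at hx
        rw [(hd x).deriv, ← mul_sub]
        exact mul_nonpos_of_nonneg_of_nonpos (by linarith)
          (sub_nonpos.2 (le_shift_rpow (by linarith) hx.2.le (by linarith) hb)))
    have := hm (Set.left_mem_Icc.2 h1) (Set.right_mem_Icc.2 h1) h1
    simp only at this
    linarith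

/-- Since B^b ≤ B, the expression decreases in A up to 1 - B, where `shift_rpow_le_dual` shows that
it is nonnegative. -/
lemma dual_nonneg_of_le {A B b : ℝ} (hA : 0 ≤ A) (hB : 0 ≤ B) (hb : 1 ≤ b) (hAB : A + B ≤ 1) :
    0 ≤ A ^ (b + 1) + B ^ (b + 1) - (1 + 1 / b) * (A ^ b + B ^ b - A ^ b * B ^ b) + 1 / b := by
  have hm := antitoneOn_of_deriv_nonpos (convex_Icc A (1 - B))
      (fun x _ => (hasDerivAt_dual (B := B) hb).continuousAt.continuousWithinAt)
      (fun x _ => (hasDerivAt_dual (B := B) hb).differentiableAt.differentiableWithinAt)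
      (fun x hx => by
        rw [interior_Icc, Set.mem_Ioo] at hx
        rw [(hasDerivAt_dual (B := B) hb).deriv]
        have h1 : B ^ b ≤ B := by
          simpa using Real.rpow_le_rpow_of_exponent_ge' hB (by linarith) zero_le_one hb
        have h2 : 0 ≤ x ^ (b - 1) := Real.rpow_nonneg (by linarith) _
        exact mul_nonpos_of_nonneg_of_nonpos (by linarith)
          (mul_nonpos_of_nonneg_of_nonpos h2 (by linarith)))
  have h1 : A ≤ 1 - B := by linarith
  have := hm (Set.left_mem_Icc.2 h1) (Set.right_mem_Icc.2 h1) h1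
  simp only at this
  have h2 := shift_rpow_le_dual (A := 1 - B) (by linarith) hB hb (by linarith)
  have h3 : 0 ≤ (1 - B + B - 1) ^ (b + 1) := Real.rpow_nonneg (by linarith) _
  linarith

/-- The Bregman divergence of `x ↦ x ^ p`. -/
def breg (p u v : ℝ) : ℝ := u ^ p + (p - 1) * v ^ p - p * (u * v ^ (p - 1))

lemma young_breg {p u s : ℝ} (hp : 1 < p) (hu : 0 ≤ u) (hs : 0 ≤ s) :
    p * (u * s) ≤ u ^ p + (p - 1) * s ^ (1 / (p - 1) + 1) := by
  have hp1 : 0 < p - 1 := by linarith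
  have hc : p.HolderConjugate (1 / (p - 1) + 1) := by
    rw [Real.holderConjugate_iff]; refine ⟨hp, ?_⟩
    have : 1 / (p - 1) + 1 = p / (p - 1) := by field_simp; ring
    rw [this]; field_simp; ring
  have h := Real.young_inequality_of_nonneg hu hs hc
  have h2 := mul_le_mul_of_nonneg_left h (show 0 ≤ p by linarith)
  refine h2.trans_eq ?_
  have : 1 / (p - 1) + 1 = p / (p - 1) := by field_simp; ring
  rw [this]; field_simp

lemma breg_nonneg {p u v : ℝ} (hp : 1 < p) (hu : 0 ≤ u) (hv : 0 ≤ v) : 0 ≤ breg p u v := by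
  have h := young_breg hp hu (Real.rpow_nonneg hv (p - 1))
  rw [← Real.rpow_mul hv, show (p - 1) * (1 / (p - 1) + 1) = p by
    have : p - 1 ≠ 0 := by linarith
    field_simp; ring] at h
  unfold breg; linarith

/-- The left side is the tangent plane of `breg p` at (r, 1). With A = v^(p-1), B = r^(p-1) and b =
1/(p-1) ≥ 1, the variable u enters the difference only through u^p - p u (A + B - 1). Young's
inequality eliminates it and leaves the one-parameter family `shift_rpow_le_dual`. -/
lemma breg_tangent {p r u v : ℝ} (hp : 1 < p) (hp2 : p ≤ 2) (hr : 0 ≤ r) (hu : 0 ≤ u)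
    (hv : 0 ≤ v) :
    p * (r ^ (p - 1) - 1) * u + p * (p - 1) * (1 - r) * v
      - (p - 1) * (r ^ p + (p - 1) - p * r) ≤ breg p u v := by
  have hp1 : 0 < p - 1 := by linarith
  set b := 1 / (p - 1) with hb
  have hb1 : 1 ≤ b := by rw [hb, le_div_iff₀ hp1]; linarith
  have hpow : ∀ w : ℝ, 0 ≤ w → (w ^ (p - 1)) ^ b = w := fun w hw => by
    rw [← Real.rpow_mul hw, hb, mul_one_div_cancel hp1.ne', Real.rpow_one]
  have hpow1 : ∀ w : ℝ, 0 ≤ w → (w ^ (p - 1)) ^ (b + 1) = w ^ p := fun w hw => by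
    rw [← Real.rpow_mul hw, hb]; congr 1; field_simp; ring
  have hpb : 1 + 1 / b = p := by rw [hb]; field_simp; ring
  have h1b : 1 / b = p - 1 := by rw [hb]; field_simp
  have hA : 0 ≤ v ^ (p - 1) := Real.rpow_nonneg hv _
  have hB : 0 ≤ r ^ (p - 1) := Real.rpow_nonneg hr _
  unfold breg
  rcases le_total 0 (v ^ (p - 1) + r ^ (p - 1) - 1) with hs | hs
  · have h1 := shift_rpow_le_dual hA hB hb1 hs
    have h2 := young_breg hp hu hs
    rw [hpow1 v hv, hpow1 r hr, hpow v hv, hpow r hr, hpb, h1b] at h1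
    have h3 := mul_le_mul_of_nonneg_left h1 hp1.le
    rw [← hb] at h2
    nlinarith
  -- If A + B - 1 ≤ 0, the terms in u are already nonnegative and Young's inequality is not needed.
  · have h1 := dual_nonneg_of_le hA hB hb1 (by linarith)
    rw [hpow1 v hv, hpow1 r hr, hpow v hv, hpow r hr, hpb, h1b] at h1
    have h3 := mul_le_mul_of_nonneg_left h1 hp1.le
    have h4 : 0 ≤ u ^ p := Real.rpow_nonneg hu _
    have h5 : p * u * (v ^ (p - 1) + r ^ (p - 1) - 1) ≤ 0 :=
      mul_nonpos_of_nonneg_of_nonpos (by positivity) hs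
    nlinarith

/-! ### Increments of powers and of their Bregman divergences. -/

lemma rpow_sub_le_mul {x y r : ℝ} (hx : 0 ≤ x) (hxy : x ≤ y) (hr : 1 ≤ r) :
    y ^ r - x ^ r ≤ r * (y - x) * y ^ (r - 1) := by
  rcases eq_or_lt_of_le (hx.trans hxy) with hy | hy
  · have : x = 0 := by linarith
    subst this; rw [← hy]; simp
  · have h := one_add_mul_self_le_rpow_one_add (s := x / y - 1) (p := r)
      (by have : 0 ≤ x / y := by positivity
          linarith) hr
    rw [add_sub_cancel, Real.div_rpow hx hy.le, le_div_iff₀ (by positivity)] at h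
    have h3 : y ^ r = y ^ (r - 1) * y := by rw [Real.rpow_sub_one hy.ne']; field_simp
    have h4 : (1 + r * (x / y - 1)) * y ^ r = y ^ r - r * (y - x) * y ^ (r - 1) := by
      rw [h3]; field_simp; ring
    linarith

/-- The trapezoidal rule overestimates the integral of r t^(r-1), which is convex for r ≥ 2. Halving
the weight of the larger endpoint gives room in `contraction_copy` when q ≥ 3. -/
lemma rpow_sub_le_trapezoid {x y r : ℝ} (hx : 0 ≤ x) (hxy : x ≤ y) (hr : 2 ≤ r) :
    y ^ r - x ^ r ≤ r * (y - x) * (1 / 2 * x ^ (r - 1) + 1 / 2 * y ^ (r - 1)) := by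
  have hd : ∀ t : ℝ, HasDerivAt (fun t : ℝ => r * (t - x) * (1 / 2 * x ^ (r - 1) + 1 / 2 * t ^ (r - 1))
      - t ^ r) (r * (1 / 2 * x ^ (r - 1) + 1 / 2 * t ^ (r - 1))
        + r * (t - x) * (1 / 2 * ((r - 1) * t ^ (r - 1 - 1))) - r * t ^ (r - 1)) t := fun t => by
    have h1 : HasDerivAt (fun t : ℝ => t ^ r) (r * t ^ (r - 1)) t :=
      Real.hasDerivAt_rpow_const (Or.inr (by linarith))
    have h2 : HasDerivAt (fun t : ℝ => t ^ (r - 1)) ((r - 1) * t ^ (r - 1 - 1)) t :=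
      Real.hasDerivAt_rpow_const (Or.inr (by linarith))
    have h3 : HasDerivAt (fun t : ℝ => r * (t - x)) r t := by
      simpa using ((hasDerivAt_id t).sub_const x).const_mul r
    exact (h3.mul ((h2.const_mul (1 / 2)).const_add _)).sub h1
  have hm := monotoneOn_of_deriv_nonneg (convex_Icc x y)
      (fun t _ => (hd t).continuousAt.continuousWithinAt)
      (fun t _ => (hd t).differentiableAt.differentiableWithinAt) (fun t ht => by
        rw [interior_Icc, Set.mem_Ioo] at ht
        rw [(hd t).deriv]
        have h := rpow_sub_le_mul (r := r - 1) hx ht.1.le (by linarith)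
        nlinarith)
  have := hm (Set.left_mem_Icc.2 hxy) (Set.right_mem_Icc.2 hxy) hxy
  simp only [sub_self, mul_zero, zero_mul] at this
  linarith

/-- The left side is the divergence between t^(q-1) and 1. The right side minus the left vanishes at
t = 1 and has derivative -q(1 - t)(1 - t^(q-2)) ≤ 0. -/
lemma breg_rpow_one_le {q t : ℝ} (hq : 2 ≤ q) (ht : 0 ≤ t) (ht1 : t ≤ 1) :
    t ^ q + 1 / (q - 1) - q / (q - 1) * t ^ (q - 1) ≤ q / 2 * (1 - t) ^ 2 := by
  have hq1 : 0 < q - 1 := by linarith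
  have hd : ∀ t : ℝ, HasDerivAt (fun t : ℝ => q / 2 * (1 - t) ^ 2 - (t ^ q + 1 / (q - 1)
      - q / (q - 1) * t ^ (q - 1))) (-q * (1 - t) - (q * t ^ (q - 1) - q * t ^ (q - 1 - 1))) t :=
    fun t => by
    have h1 : HasDerivAt (fun t : ℝ => t ^ q) (q * t ^ (q - 1)) t :=
      Real.hasDerivAt_rpow_const (Or.inr (by linarith))
    have h2 : HasDerivAt (fun t : ℝ => t ^ (q - 1)) ((q - 1) * t ^ (q - 1 - 1)) t :=
      Real.hasDerivAt_rpow_const (Or.inr (by linarith))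
    have h3 := (((hasDerivAt_id t).const_sub 1).pow 2).const_mul (q / 2)
    have h4 := h3.sub ((h1.add_const (1 / (q - 1))).sub (h2.const_mul (q / (q - 1))))
    refine h4.congr_deriv ?_
    simp; field_simp
  have hm := antitoneOn_of_deriv_nonpos (convex_Icc t 1)
      (fun t _ => (hd t).continuousAt.continuousWithinAt)
      (fun t _ => (hd t).differentiableAt.differentiableWithinAt) (fun s hs => by
        rw [interior_Icc, Set.mem_Ioo] at hs
        rw [(hd s).deriv]
        have hs0 : 0 < s := by linarith
        have h1 : s ^ (q - 1) = s ^ (q - 1 - 1) * s := by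
          rw [Real.rpow_sub_one hs0.ne' (q - 1)]; field_simp
        have h2 : s ^ (q - 1 - 1) ≤ 1 := Real.rpow_le_one hs0.le hs.2.le (by linarith)
        rw [h1]
        have : 0 ≤ q * ((1 - s) * (1 - s ^ (q - 1 - 1))) :=
          mul_nonneg (by linarith) (mul_nonneg (by linarith) (by linarith))
        linarith)
  have := hm (Set.left_mem_Icc.2 ht1) (Set.right_mem_Icc.2 ht1) ht1
  have e : 1 + 1 / (q - 1) - q / (q - 1) = 0 := by field_simp; ring
  simp only [sub_self, Real.one_rpow, mul_one, e] at this
  norm_num at this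
  norm_num
  linarith

/-- The Bregman divergence of `x ^ (q / (q - 1))` between `(q - 1)`-st powers. -/
lemma breg_rpow_eq {q x y : ℝ} (hq : 1 < q) (hx : 0 ≤ x) (hy : 0 ≤ y) :
    breg (q / (q - 1)) (x ^ (q - 1)) (y ^ (q - 1)) =
      x ^ q + 1 / (q - 1) * y ^ q - q / (q - 1) * (x ^ (q - 1) * y) := by
  have hq1 : 0 < q - 1 := by linarith
  unfold breg
  rw [← Real.rpow_mul hx, ← Real.rpow_mul hy, ← Real.rpow_mul hy,
    show (q - 1) * (q / (q - 1)) = q by field_simp,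
    show (q - 1) * (q / (q - 1) - 1) = 1 by field_simp; ring, Real.rpow_one,
    show q / (q - 1) - 1 = 1 / (q - 1) by field_simp; ring]

/-- `breg_rpow_one_le` at t = x / y, rescaled by y^q. -/
lemma breg_rpow_le {q x y : ℝ} (hq : 2 ≤ q) (hx : 0 ≤ x) (hxy : x ≤ y) :
    breg (q / (q - 1)) (x ^ (q - 1)) (y ^ (q - 1)) ≤ q / 2 * (y - x) ^ 2 * y ^ (q - 2) := by
  have hq1 : 0 < q - 1 := by linarith
  rw [breg_rpow_eq (by linarith) hx (hx.trans hxy)]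
  rcases eq_or_lt_of_le (hx.trans hxy) with hy | hy
  · have : x = 0 := by linarith
    subst this; rw [← hy]; simp [Real.zero_rpow (show q ≠ 0 by linarith)]
  · have h := mul_le_mul_of_nonneg_left
      (breg_rpow_one_le hq (t := x / y) (by positivity) ((div_le_one hy).2 hxy))
      (Real.rpow_nonneg hy.le q)
    rw [Real.div_rpow hx hy.le, Real.div_rpow hx hy.le] at h
    have e1 : y ^ q = y ^ (q - 2) * y ^ 2 := by
      rw [← Real.rpow_natCast, ← Real.rpow_add hy]; norm_num
    have e2 : y ^ q = y ^ (q - 1) * y := by rw [Real.rpow_sub_one hy.ne']; field_simp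
    have e3 : y ^ q * (x ^ q / y ^ q + 1 / (q - 1) - q / (q - 1) * (x ^ (q - 1) / y ^ (q - 1)))
        = x ^ q + 1 / (q - 1) * y ^ q - q / (q - 1) * (x ^ (q - 1) * y) := by
      have : y ^ q * (x ^ (q - 1) / y ^ (q - 1)) = x ^ (q - 1) * y := by
        rw [e2]; field_simp
      have h5 : y ^ q * (x ^ q / y ^ q) = x ^ q := by field_simp
      linear_combination h5 - q / (q - 1) * this
    have e4 : y ^ q * (q / 2 * (1 - x / y) ^ 2) = q / 2 * (y - x) ^ 2 * y ^ (q - 2) := by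
      rw [e1]; field_simp
    linarith

/-- A product of increments bounded with a weight `a x ^ (q-2) + b (x + d) ^ (q-2)`, which is a
trapezoidal rule when `3 ≤ q`. -/
lemma rpow_sub_mul_sub_le {q a b x y d : ℝ} (hq : 2 ≤ q)
    (hab : a = 0 ∧ b = 1 ∨ 3 ≤ q ∧ a = 1 / 2 ∧ b = 1 / 2) (hx : 0 ≤ x) (hxy : x ≤ y)
    (hyd : y ≤ x + d) :
    (y ^ (q - 1) - x ^ (q - 1)) * (y - x)
      ≤ q * (d ^ 2 * (a * x ^ (q - 2) + b * (x + d) ^ (q - 2))) := by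
  have hy := hx.trans hxy
  have h1 : y ^ (q - 1) - x ^ (q - 1) ≤
      (q - 1) * (y - x) * (a * x ^ (q - 2) + b * y ^ (q - 2)) := by
    rcases hab with ⟨rfl, rfl⟩ | ⟨h3, rfl, rfl⟩
    · have := rpow_sub_le_mul (r := q - 1) hx hxy (by linarith)
      rw [show q - 1 - 1 = q - 2 by ring] at this
      simpa using this
    · have := rpow_sub_le_trapezoid (r := q - 1) hx hxy (by linarith)
      rwa [show q - 1 - 1 = q - 2 by ring] at this
  have ha : 0 ≤ a := by rcases hab with ⟨rfl, -⟩ | ⟨-, rfl, -⟩ <;> norm_num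
  have hb : 0 ≤ b := by rcases hab with ⟨-, rfl⟩ | ⟨-, -, rfl⟩ <;> norm_num
  have hyx : 0 ≤ y - x := by linarith
  have h0 : 0 ≤ a * x ^ (q - 2) + b * y ^ (q - 2) := by positivity
  calc (y ^ (q - 1) - x ^ (q - 1)) * (y - x)
      ≤ ((q - 1) * (y - x) * (a * x ^ (q - 2) + b * y ^ (q - 2))) * (y - x) := by gcongr
    _ = (q - 1) * ((y - x) ^ 2 * (a * x ^ (q - 2) + b * y ^ (q - 2))) := by ring
    _ ≤ _ := by
        have : y - x ≤ d := by linarith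
        have h2 : 0 ≤ q - 2 := by linarith
        have h3 : q - 1 ≤ q := by linarith
        gcongr

/-! ### Subadditivity of the entropy of `x ^ p` -/

lemma integrable_of_bounds {α : Type*} [MeasurableSpace α] {μ : Measure α} [IsFiniteMeasure μ]
    {f : α → ℝ} (hf : Measurable f) {B : ℝ} (h0 : ∀ x, 0 ≤ f x) (hB : ∀ x, f x ≤ B) :
    Integrable f μ :=
  Integrable.of_bound hf.aestronglyMeasurable B
    (ae_of_all _ fun x => by rw [Real.norm_eq_abs, abs_of_nonneg (h0 x)]; exact hB x)

lemma breg_le {p u v B : ℝ} (hp : 1 < p) (hu : 0 ≤ u) (hv : 0 ≤ v) (huB : u ≤ B) (hvB : v ≤ B) :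
    breg p u v ≤ B ^ p + (p - 1) * B ^ p := by
  unfold breg
  have h1 : u ^ p ≤ B ^ p := Real.rpow_le_rpow hu huB (by linarith)
  have h2 : v ^ p ≤ B ^ p := Real.rpow_le_rpow hv hvB (by linarith)
  have h3 : 0 ≤ p * (u * v ^ (p - 1)) := by
    have := Real.rpow_nonneg hv (p - 1)
    have : 0 ≤ p := by linarith
    positivity
  nlinarith

lemma measurable_breg {α : Type*} [MeasurableSpace α] {f a : α → ℝ} (hf : Measurable f)
    (ha : Measurable a) (p : ℝ) : Measurable fun x => breg p (f x) (a x) := by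
  unfold breg; fun_prop

lemma integrable_breg {α : Type*} [MeasurableSpace α] {μ : Measure α} [IsFiniteMeasure μ]
    {f a : α → ℝ} (hf : Measurable f) (ha : Measurable a) {B p : ℝ} (hp : 1 < p)
    (hf0 : ∀ x, 0 ≤ f x) (hfB : ∀ x, f x ≤ B) (ha0 : ∀ x, 0 ≤ a x) (haB : ∀ x, a x ≤ B) :
    Integrable (fun x => breg p (f x) (a x)) μ :=
  integrable_of_bounds (measurable_breg hf ha p) (fun x => breg_nonneg hp (hf0 x) (ha0 x))
    (fun x => breg_le hp (hf0 x) (ha0 x) (hfB x) (haB x))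

lemma integrable_rpow {α : Type*} [MeasurableSpace α] {μ : Measure α} [IsFiniteMeasure μ]
    {f : α → ℝ} (hf : Measurable f) {B p : ℝ} (hp : 0 ≤ p)
    (hf0 : ∀ x, 0 ≤ f x) (hfB : ∀ x, f x ≤ B) : Integrable (fun x => f x ^ p) μ :=
  integrable_of_bounds (hf.pow_const p) (fun x => Real.rpow_nonneg (hf0 x) _)
    (fun x => Real.rpow_le_rpow (hf0 x) (hfB x) hp)

lemma integral_nonneg_le {α : Type*} [MeasurableSpace α] {μ : Measure α} [IsProbabilityMeasure μ]
    {f : α → ℝ} (hf : Measurable f) {B : ℝ} (h0 : ∀ x, 0 ≤ f x) (hB : ∀ x, f x ≤ B) :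
    0 ≤ ∫ x, f x ∂μ ∧ ∫ x, f x ∂μ ≤ B := by
  refine ⟨integral_nonneg h0, ?_⟩
  have := integral_mono (integrable_of_bounds (μ := μ) hf h0 hB) (integrable_const B) hB
  simpa using this

lemma breg_smul {p c u v : ℝ} (hc : 0 < c) (hu : 0 ≤ u) (hv : 0 ≤ v) :
    breg p (c * u) (c * v) = c ^ p * breg p u v := by
  unfold breg
  rw [Real.mul_rpow hc.le hu, Real.mul_rpow hc.le hv, Real.mul_rpow hc.le hv]
  have : c ^ p = c * c ^ (p - 1) := by rw [Real.rpow_sub_one hc.ne']; field_simp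
  linear_combination (- p * u * v ^ (p - 1)) * -this

lemma integral_affine {α : Type*} [MeasurableSpace α] {μ : Measure α} [IsProbabilityMeasure μ]
    {f g : α → ℝ} (hf : Integrable f μ) (hg : Integrable g μ) (A B c : ℝ) :
    ∫ x, (A * f x + B * g x - c) ∂μ = A * ∫ x, f x ∂μ + B * ∫ x, g x ∂μ - c := by
  have hA : Integrable (fun x => A * f x) μ := hf.const_mul A
  have hB : Integrable (fun x => B * g x) μ := hg.const_mul B
  have hAB : Integrable (fun x => A * f x + B * g x) μ := hA.add hB
  rw [integral_sub hAB (integrable_const _), integral_add hA hB, integral_const_mul,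
    integral_const_mul]
  simp

/-- Jensen's inequality for a jointly convex function. As `breg p` is homogeneous of degree p, one
may scale to ∫ a = 1 and integrate the tangent plane at (r, 1) with r = ∫ f / ∫ a. -/
lemma breg_integral_le {α : Type*} [MeasurableSpace α] {μ : Measure α} [IsProbabilityMeasure μ]
    {f a : α → ℝ} (hf : Measurable f) (ha : Measurable a) {B p : ℝ} (hp : 1 < p) (hp2 : p ≤ 2)
    (hf0 : ∀ x, 0 ≤ f x) (hfB : ∀ x, f x ≤ B) (ha0 : ∀ x, 0 ≤ a x) (haB : ∀ x, a x ≤ B) :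
    breg p (∫ x, f x ∂μ) (∫ x, a x ∂μ) ≤ ∫ x, breg p (f x) (a x) ∂μ := by
  have hfi := integrable_of_bounds (μ := μ) hf hf0 hfB
  have hai := integrable_of_bounds (μ := μ) ha ha0 haB
  have hbi := integrable_breg (μ := μ) hf ha hp hf0 hfB ha0 haB
  have hu0 := (integral_nonneg_le (μ := μ) hf hf0 hfB).1
  have hv0 := (integral_nonneg_le (μ := μ) ha ha0 haB).1
  rcases eq_or_lt_of_le hv0 with hv | hv
  -- Scaling is impossible when ∫ a = 0; then a vanishes almost everywhere and the claim is Jensen's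
  -- inequality for x^p.
  · have h0 : a =ᵐ[μ] 0 := (integral_eq_zero_iff_of_nonneg ha0 hai).1 hv.symm
    have hz : ∀ u : ℝ, breg p u 0 = u ^ p := fun u => by
      simp [breg, Real.zero_rpow (show p ≠ 0 by linarith), Real.zero_rpow (show p - 1 ≠ 0 by linarith)]
    have h1 : ∫ x, breg p (f x) (a x) ∂μ = ∫ x, f x ^ p ∂μ :=
      integral_congr_ae (by filter_upwards [h0] with x hx; simp only [hx, Pi.zero_apply, hz])
    rw [h1, ← hv, hz]
    exact (convexOn_rpow hp.le).map_integral_le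
      (Real.continuous_rpow_const (by linarith)).continuousOn isClosed_Ici
      (ae_of_all _ hf0) hfi (integrable_rpow hf (by linarith) hf0 hfB)
  · set u := ∫ x, f x ∂μ
    set v := ∫ x, a x ∂μ
    set r := u / v with hr
    have hr0 : 0 ≤ r := by positivity
    have key : ∀ x, p * (r ^ (p - 1) - 1) * (v⁻¹ * f x) + p * (p - 1) * (1 - r) * (v⁻¹ * a x)
      - (p - 1) * (r ^ p + (p - 1) - p * r) ≤ (v⁻¹) ^ p * breg p (f x) (a x) := fun x => by
      rw [← breg_smul (inv_pos.2 hv) (hf0 x) (ha0 x)]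
      exact breg_tangent hp hp2 hr0 (mul_nonneg (inv_pos.2 hv).le (hf0 x))
        (mul_nonneg (inv_pos.2 hv).le (ha0 x))
    have h1 := integral_mono (μ := μ) ((((hfi.const_mul v⁻¹).const_mul (p * (r ^ (p - 1) - 1))).add
      ((hai.const_mul v⁻¹).const_mul (p * (p - 1) * (1 - r)))).sub (integrable_const
        ((p - 1) * (r ^ p + (p - 1) - p * r)))) (hbi.const_mul (v⁻¹ ^ p)) key
    have h2 : ∫ x, (p * (r ^ (p - 1) - 1) * (v⁻¹ * f x) + p * (p - 1) * (1 - r) * (v⁻¹ * a x)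
      - (p - 1) * (r ^ p + (p - 1) - p * r)) ∂μ = p * (r ^ (p - 1) - 1) * (v⁻¹ * u)
        + p * (p - 1) * (1 - r) * (v⁻¹ * v) - (p - 1) * (r ^ p + (p - 1) - p * r) := by
      rw [integral_affine (hfi.const_mul v⁻¹) (hai.const_mul v⁻¹), integral_const_mul,
        integral_const_mul]
    have h3 : breg p r 1 = p * (r ^ (p - 1) - 1) * (v⁻¹ * u)
        + p * (p - 1) * (1 - r) * (v⁻¹ * v) - (p - 1) * (r ^ p + (p - 1) - p * r) := by
      have e1 : v⁻¹ * u = r := by rw [hr]; field_simp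
      have e3 : r ^ p = r ^ (p - 1) * r := by
        rcases eq_or_lt_of_le hr0 with h | h
        · rw [← h, Real.zero_rpow (by linarith)]; simp
        · rw [Real.rpow_sub_one h.ne']; field_simp
      rw [e1, inv_mul_cancel₀ hv.ne']; unfold breg
      rw [Real.one_rpow, Real.one_rpow, e3]; ring
    have h4 : breg p u v = v ^ p * breg p r 1 := by
      rw [← breg_smul hv hr0 zero_le_one, hr]; congr 1 <;> field_simp
    have h5 : v⁻¹ ^ p * v ^ p = 1 := by
      rw [← Real.mul_rpow (inv_pos.2 hv).le hv.le, inv_mul_cancel₀ hv.ne', Real.one_rpow]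
    have h6 : ∫ x, v⁻¹ ^ p * breg p (f x) (a x) ∂μ = v⁻¹ ^ p * ∫ x, breg p (f x) (a x) ∂μ :=
      integral_const_mul _ _
    have h7 : breg p r 1 ≤ v⁻¹ ^ p * ∫ x, breg p (f x) (a x) ∂μ := by
      rw [h3, ← h2, ← h6]; exact h1
    rw [h4]
    calc v ^ p * breg p r 1 ≤ v ^ p * (v⁻¹ ^ p * ∫ x, breg p (f x) (a x) ∂μ) := by gcongr
      _ = (v⁻¹ ^ p * v ^ p) * ∫ x, breg p (f x) (a x) ∂μ := by ring
      _ = _ := by rw [h5, one_mul]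

/-- The gap between the two sides is exactly `breg p (∫ f) c`, which is nonnegative. -/
lemma entropy_le_breg {α : Type*} [MeasurableSpace α] {μ : Measure α} [IsProbabilityMeasure μ]
    {f : α → ℝ} (hf : Measurable f) {B p c : ℝ} (hp : 1 < p)
    (hf0 : ∀ x, 0 ≤ f x) (hfB : ∀ x, f x ≤ B) (hc0 : 0 ≤ c) :
    ∫ x, f x ^ p ∂μ - (∫ x, f x ∂μ) ^ p ≤ ∫ x, breg p (f x) c ∂μ := by
  have hfi := integrable_of_bounds (μ := μ) hf hf0 hfB
  have hfp := integrable_rpow (μ := μ) hf (p := p) (by linarith) hf0 hfB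
  have h := breg_nonneg hp (integral_nonneg (μ := μ) hf0) hc0
  have e : ∀ x, breg p (f x) c = 1 * f x ^ p + (-(p * c ^ (p - 1))) * f x - -((p - 1) * c ^ p) :=
    fun x => by unfold breg; ring
  rw [integral_congr_ae (ae_of_all _ e), integral_affine hfp hfi]
  unfold breg at h
  linarith

section Cons

variable {𝒳 : Type*} [MeasurableSpace 𝒳] {n : ℕ}

lemma measurable_finCons : Measurable fun z : 𝒳 × (Fin n → 𝒳) => (Fin.cons z.1 z.2 : Fin (n + 1) → 𝒳) := by
  refine measurable_pi_lambda _ fun i => ?_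
  refine Fin.cases ?_ (fun j => ?_) i
  · simpa using measurable_fst
  · simp only [Fin.cons_succ]; exact (measurable_pi_apply j).comp measurable_snd

lemma measurePreserving_finCons (μ : Fin (n + 1) → Measure 𝒳) [∀ i, IsProbabilityMeasure (μ i)] :
    MeasurePreserving (fun z : 𝒳 × (Fin n → 𝒳) => (Fin.cons z.1 z.2 : Fin (n + 1) → 𝒳))
      ((μ 0).prod (Measure.pi fun j => μ j.succ)) (Measure.pi μ) := by
  have h := (measurePreserving_piFinSuccAbove μ 0).symm
  convert h using 1
  · ext z : 1
    simp [MeasurableEquiv.piFinSuccAbove]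
    rfl
  · simp

lemma integral_pi_succ (μ : Fin (n + 1) → Measure 𝒳) [∀ i, IsProbabilityMeasure (μ i)]
    {f : (Fin (n + 1) → 𝒳) → ℝ} (hf : Measurable f) {B : ℝ} (h0 : ∀ x, 0 ≤ f x)
    (hB : ∀ x, f x ≤ B) :
    ∫ x, f x ∂Measure.pi μ = ∫ z, ∫ y, f (Fin.cons y z) ∂μ 0 ∂Measure.pi fun j => μ j.succ := by
  have h := measurePreserving_finCons μ
  rw [← h.map_eq, integral_map h.measurable.aemeasurable hf.aestronglyMeasurable,
    integral_prod_symm]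
  exact integrable_of_bounds (hf.comp h.measurable) (fun _ => h0 _) (fun _ => hB _)

end Cons

/-- Subadditivity of the entropy of `x ^ p`, with an arbitrary reference `a i` not depending on
the `i`-th coordinate. -/
theorem entropy_pi_le {𝒳 : Type*} [MeasurableSpace 𝒳] {p : ℝ} (hp : 1 < p) (hp2 : p ≤ 2) {n : ℕ}
    (μ : Fin n → Measure 𝒳) [∀ i, IsProbabilityMeasure (μ i)]
    {f : (Fin n → 𝒳) → ℝ} {a : Fin n → (Fin n → 𝒳) → ℝ} (hf : Measurable f)
    (ha : ∀ i, Measurable (a i)) {B : ℝ} (hf0 : ∀ x, 0 ≤ f x) (hfB : ∀ x, f x ≤ B)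
    (ha0 : ∀ i x, 0 ≤ a i x) (haB : ∀ i x, a i x ≤ B)
    (hind : ∀ i x y, a i (Function.update x i y) = a i x) :
    ∫ x, f x ^ p ∂Measure.pi μ - (∫ x, f x ∂Measure.pi μ) ^ p ≤
      ∑ i, ∫ x, breg p (f x) (a i x) ∂Measure.pi μ := by
  induction n with
  | zero =>
    have h : f = fun _ => f default := funext fun x => by rw [Subsingleton.elim x default]
    rw [h]; simp
  | succ n ih =>
    set ν := Measure.pi fun j : Fin n => μ j.succ
    have hm : ∀ z : Fin n → 𝒳, Measurable fun y : 𝒳 => (Fin.cons y z : Fin (n + 1) → 𝒳) :=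
      fun z => measurable_finCons.comp (measurable_id.prodMk measurable_const)
    have hsw : Measurable fun w : (Fin n → 𝒳) × 𝒳 => (Fin.cons w.2 w.1 : Fin (n + 1) → 𝒳) :=
      measurable_finCons.comp measurable_swap
    have hint : ∀ {k : (Fin (n + 1) → 𝒳) → ℝ}, Measurable k →
        Measurable fun z : Fin n → 𝒳 => ∫ y, k (Fin.cons y z) ∂μ 0 := fun {k} hk =>
      ((hk.comp hsw).stronglyMeasurable.integral_prod_right').measurable
    have hbd : ∀ {k : (Fin (n + 1) → 𝒳) → ℝ} {C : ℝ}, Measurable k → (∀ x, 0 ≤ k x) →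
        (∀ x, k x ≤ C) → ∀ z : Fin n → 𝒳,
        0 ≤ ∫ y, k (Fin.cons y z) ∂μ 0 ∧ ∫ y, k (Fin.cons y z) ∂μ 0 ≤ C :=
      fun hk h0 hC z => integral_nonneg_le (hk.comp (hm z)) (fun _ => h0 _) (fun _ => hC _)
    -- Coordinate 0 is integrated out. The averaged references still ignore their own coordinate, so
    -- the induction hypothesis applies to g and b.
    set g : (Fin n → 𝒳) → ℝ := fun z => ∫ y, f (Fin.cons y z) ∂μ 0
    set b : Fin n → (Fin n → 𝒳) → ℝ := fun j z => ∫ y, a j.succ (Fin.cons y z) ∂μ 0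
    have hg0 : ∀ z, 0 ≤ g z := fun z => (hbd hf hf0 hfB z).1
    have hgB : ∀ z, g z ≤ B := fun z => (hbd hf hf0 hfB z).2
    have hb0 : ∀ j z, 0 ≤ b j z := fun j z => (hbd (ha j.succ) (ha0 j.succ) (haB j.succ) z).1
    have hbB : ∀ j z, b j z ≤ B := fun j z => (hbd (ha j.succ) (ha0 j.succ) (haB j.succ) z).2
    have hI := ih (fun j => μ j.succ) (hint hf) (fun j => hint (ha j.succ)) hg0 hgB hb0 hbB
      (fun j z y => by
        refine integral_congr_ae (ae_of_all _ fun w => ?_)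
        simp only [Fin.cons_update, hind])
    have hbreg0 : ∀ i x, 0 ≤ breg p (f x) (a i x) := fun i x => breg_nonneg hp (hf0 x) (ha0 i x)
    have hbregB : ∀ i x, breg p (f x) (a i x) ≤ B ^ p + (p - 1) * B ^ p := fun i x =>
      breg_le hp (hf0 x) (ha0 i x) (hfB x) (haB i x)
    have hfp0 : ∀ x, 0 ≤ f x ^ p := fun x => Real.rpow_nonneg (hf0 x) _
    have hfpB : ∀ x, f x ^ p ≤ B ^ p := fun x => Real.rpow_le_rpow (hf0 x) (hfB x) (by linarith)
    rw [Fin.sum_univ_succ, integral_pi_succ μ (hf.pow_const p) hfp0 hfpB,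
      integral_pi_succ μ hf hf0 hfB,
      integral_pi_succ μ (measurable_breg hf (ha 0) p) (hbreg0 0) (hbregB 0)]
    -- Joint convexity enters here: averaging over coordinate 0 before taking the divergence can
    -- only decrease it.
    have h1 : ∑ j : Fin n, ∫ z, breg p (g z) (b j z) ∂ν ≤
        ∑ j : Fin n, ∫ x, breg p (f x) (a j.succ x) ∂Measure.pi μ := by
      refine Finset.sum_le_sum fun j _ => ?_
      rw [integral_pi_succ μ (measurable_breg hf (ha j.succ) p) (hbreg0 j.succ) (hbregB j.succ)]
      refine integral_mono (integrable_breg (hint hf) (hint (ha j.succ)) hp hg0 hgB (hb0 j) (hbB j))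
        ?_ fun z => breg_integral_le (hf.comp (hm z)) ((ha j.succ).comp (hm z)) hp hp2
          (fun _ => hf0 _) (fun _ => hfB _) (fun _ => ha0 _ _) (fun _ => haB _ _)
      exact integrable_of_bounds (hint (measurable_breg hf (ha j.succ) p))
        (fun z => (hbd (measurable_breg hf (ha j.succ) p) (hbreg0 j.succ) (hbregB j.succ) z).1)
        (fun z => (hbd (measurable_breg hf (ha j.succ) p) (hbreg0 j.succ) (hbregB j.succ) z).2)
    have hfpi : Integrable (fun z => ∫ y, f (Fin.cons y z) ^ p ∂μ 0) ν :=
      integrable_of_bounds (hint (hf.pow_const p)) (fun z => (hbd (hf.pow_const p) hfp0 hfpB z).1)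
        (fun z => (hbd (hf.pow_const p) hfp0 hfpB z).2)
    have hgp : Integrable (fun z => g z ^ p) ν :=
      integrable_rpow (hint hf) (by linarith) hg0 hgB
    -- The remaining entropy is that of coordinate 0 with z frozen, where the reference a 0 is a
    -- constant.
    have h2 : ∫ z, ∫ y, f (Fin.cons y z) ^ p ∂μ 0 ∂ν - ∫ z, g z ^ p ∂ν ≤
        ∫ z, ∫ y, breg p (f (Fin.cons y z)) (a 0 (Fin.cons y z)) ∂μ 0 ∂ν := by
      rw [← integral_sub hfpi hgp]
      refine integral_mono (hfpi.sub hgp) (integrable_of_bounds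
        (hint (measurable_breg hf (ha 0) p))
        (fun z => (hbd (measurable_breg hf (ha 0) p) (hbreg0 0) (hbregB 0) z).1)
        (fun z => (hbd (measurable_breg hf (ha 0) p) (hbreg0 0) (hbregB 0) z).2)) fun z => ?_
      rcases isEmpty_or_nonempty 𝒳 with h𝒳 | ⟨⟨w⟩⟩
      · exact absurd (measure_univ (μ := μ 0)) (by simp [Measure.eq_zero_of_isEmpty])
      · have hc : ∀ y, a 0 (Fin.cons y z) = a 0 (Fin.cons w z) := fun y => by
          rw [← hind 0 (Fin.cons w z) y, Fin.update_cons_zero]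
        simp only [hc]
        exact entropy_le_breg (hf.comp (hm z)) hp (fun _ => hf0 _) (fun _ => hfB _) (ha0 _ _)
    linarith

/-! ### Resampling one coordinate -/

section Resample

variable {𝒳 : Type*} {n : ℕ}

/-- The vector `x` with its `i`-th coordinate replaced by that of `x'`, from `(x, x')`. -/
def resample (i : Fin n) (z : (Fin n → 𝒳) × (Fin n → 𝒳)) : Fin n → 𝒳 :=
  Function.update z.1 i (z.2 i)

/-- Exchange of the `i`-th coordinates of `x` and `x'`. -/
def exchange (i : Fin n) (z : (Fin n → 𝒳) × (Fin n → 𝒳)) : (Fin n → 𝒳) × (Fin n → 𝒳) :=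
  (Function.update z.1 i (z.2 i), Function.update z.2 i (z.1 i))

@[simp] lemma exchange_fst (i : Fin n) (z : (Fin n → 𝒳) × (Fin n → 𝒳)) :
    (exchange i z).1 = resample i z := rfl

@[simp] lemma resample_exchange (i : Fin n) (z : (Fin n → 𝒳) × (Fin n → 𝒳)) :
    resample i (exchange i z) = z.1 := by
  simp [resample, exchange]

variable [MeasurableSpace 𝒳]

lemma measurable_resample (i : Fin n) :
    Measurable (resample i : (Fin n → 𝒳) × (Fin n → 𝒳) → Fin n → 𝒳) := by
  refine measurable_pi_lambda _ fun j => ?_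
  unfold resample
  rcases eq_or_ne j i with rfl | h
  · simp only [Function.update_self]; fun_prop
  · simp only [Function.update_of_ne h]; fun_prop

lemma measurePreserving_exchange (μ : Fin n → Measure 𝒳) [∀ i, IsProbabilityMeasure (μ i)]
    (i : Fin n) :
    MeasurePreserving (exchange i) ((Measure.pi μ).prod (Measure.pi μ))
      ((Measure.pi μ).prod (Measure.pi μ)) := by
  classical
  have he := measurePreserving_arrowProdEquivProdArrow 𝒳 𝒳 (Fin n) μ μ
  have hp := measurePreserving_pi (fun j => (μ j).prod (μ j)) (fun j => (μ j).prod (μ j))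
    (f := fun j => if j = i then Prod.swap else id) (fun j => by
      split_ifs
      · exact Measure.measurePreserving_swap
      · exact MeasurePreserving.id _)
  have h := (he.comp hp).comp he.symm
  convert h using 1
  ext z j
  · rcases eq_or_ne j i with rfl | hj
    · simp [exchange, MeasurableEquiv.arrowProdEquivProdArrow, Equiv.arrowProdEquivProdArrow]
    · simp [exchange, MeasurableEquiv.arrowProdEquivProdArrow, Equiv.arrowProdEquivProdArrow, hj]
  · rcases eq_or_ne j i with rfl | hj
    · simp [exchange, MeasurableEquiv.arrowProdEquivProdArrow, Equiv.arrowProdEquivProdArrow]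
    · simp [exchange, MeasurableEquiv.arrowProdEquivProdArrow, Equiv.arrowProdEquivProdArrow, hj]

lemma integral_exchange (μ : Fin n → Measure 𝒳) [∀ i, IsProbabilityMeasure (μ i)]
    (i : Fin n) {k : (Fin n → 𝒳) × (Fin n → 𝒳) → ℝ} (hk : Measurable k) :
    ∫ z, k (exchange i z) ∂(Measure.pi μ).prod (Measure.pi μ) =
      ∫ z, k z ∂(Measure.pi μ).prod (Measure.pi μ) := by
  have h := measurePreserving_exchange μ i
  conv_rhs => rw [← h.map_eq]
  rw [integral_map h.measurable.aemeasurable hk.aestronglyMeasurable]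

lemma integrable_of_abs_le {α : Type*} [MeasurableSpace α] {μ : Measure α} [IsFiniteMeasure μ]
    {f : α → ℝ} (hf : Measurable f) {B : ℝ} (hB : ∀ x, |f x| ≤ B) : Integrable f μ :=
  Integrable.of_bound hf.aestronglyMeasurable B (ae_of_all _ hB)

/-- The reference a i is the mean of f over the i-th coordinate. Then ∫ a_i^p = ∫ f a_i^(p-1), so
the divergence integrates to ∫ f (f^(p-1) - a_i^(p-1)). Concavity of t^(p-1) bounds a_i^(p-1) below
by the mean of the (p-1)-st power of the resampled f. -/
lemma entropy_le_resample (μ : Fin n → Measure 𝒳) [∀ i, IsProbabilityMeasure (μ i)] {p : ℝ}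
    (hp : 1 < p) (hp2 : p ≤ 2) {f : (Fin n → 𝒳) → ℝ} (hf : Measurable f) {B : ℝ}
    (hf0 : ∀ x, 0 ≤ f x) (hfB : ∀ x, f x ≤ B) :
    ∫ x, f x ^ p ∂Measure.pi μ - (∫ x, f x ∂Measure.pi μ) ^ p ≤
      ∑ i, ∫ z, f z.1 * (f z.1 ^ (p - 1) - f (resample i z) ^ (p - 1))
        ∂(Measure.pi μ).prod (Measure.pi μ) := by
  set ν := Measure.pi μ
  have hp1 : 0 < p - 1 := by linarith
  set a : Fin n → (Fin n → 𝒳) → ℝ := fun i x => ∫ x', f (resample i (x, x')) ∂ν with ha_def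
  have ha : ∀ i, Measurable (a i) := fun i =>
    ((hf.comp (measurable_resample i)).stronglyMeasurable.integral_prod_right').measurable
  have hr : ∀ i x, Measurable fun x' : Fin n → 𝒳 => resample i (x, x') := fun i x =>
    (measurable_resample i).comp measurable_prodMk_left
  have hab : ∀ i x, 0 ≤ a i x ∧ a i x ≤ B := fun i x =>
    integral_nonneg_le (hf.comp (hr i x)) (fun _ => hf0 _) (fun _ => hfB _)
  have hind : ∀ i x y, a i (Function.update x i y) = a i x := fun i x y => by
    simp [ha_def, resample]
  refine (entropy_pi_le hp hp2 μ hf ha hf0 hfB (fun i x => (hab i x).1) (fun i x => (hab i x).2)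
    hind).trans (Finset.sum_le_sum fun i _ => ?_)
  have hpow : ∀ w : ℝ, 0 ≤ w → w ^ p = w * w ^ (p - 1) := fun w hw => by
    rcases eq_or_lt_of_le hw with h | h
    · rw [← h, Real.zero_rpow (by linarith)]; simp
    · rw [Real.rpow_sub_one h.ne']; field_simp
  have ifp : Integrable (fun x => f x ^ p) ν := integrable_rpow hf (by linarith) hf0 hfB
  have iap : Integrable (fun x => a i x ^ p) ν :=
    integrable_rpow (ha i) (by linarith) (fun x => (hab i x).1) (fun x => (hab i x).2)
  have mul_bd : ∀ u v : ℝ, 0 ≤ u → u ≤ B → 0 ≤ v → v ≤ B →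
      0 ≤ u * v ^ (p - 1) ∧ u * v ^ (p - 1) ≤ B * B ^ (p - 1) := fun u v hu huB hv hvB =>
    ⟨mul_nonneg hu (Real.rpow_nonneg hv _),
      mul_le_mul huB (Real.rpow_le_rpow hv hvB hp1.le) (Real.rpow_nonneg hv _) (hu.trans huB)⟩
  have ifa : Integrable (fun x => f x * a i x ^ (p - 1)) ν :=
    integrable_of_bounds (hf.mul ((ha i).pow_const _))
      (fun x => (mul_bd _ _ (hf0 x) (hfB x) (hab i x).1 (hab i x).2).1)
      (fun x => (mul_bd _ _ (hf0 x) (hfB x) (hab i x).1 (hab i x).2).2)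
  have e1 : ∫ x, a i x ^ p ∂ν = ∫ x, f x * a i x ^ (p - 1) ∂ν := by
    have hm : Measurable fun z : (Fin n → 𝒳) × (Fin n → 𝒳) => f z.1 * a i z.1 ^ (p - 1) :=
      (hf.mul ((ha i).pow_const _)).comp measurable_fst
    have h1 := integral_exchange μ i hm
    have h2 : ∫ z, f z.1 * a i z.1 ^ (p - 1) ∂ν.prod ν = ∫ x, f x * a i x ^ (p - 1) ∂ν := by
      have := integral_fun_fst (μ := ν) (ν := ν) (fun x => f x * a i x ^ (p - 1))
      simpa using this
    rw [h2] at h1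
    rw [← h1]
    have h3 : ∀ z : (Fin n → 𝒳) × (Fin n → 𝒳), f (exchange i z).1 * a i (exchange i z).1 ^ (p - 1)
        = f (resample i z) * a i z.1 ^ (p - 1) := fun z => by
      rw [exchange_fst, show a i (resample i z) = a i z.1 from hind i _ _]
    simp only [h3]
    have h4 : Integrable (fun z => f (resample i z) * a i z.1 ^ (p - 1)) (ν.prod ν) :=
      integrable_of_bounds ((hf.comp (measurable_resample i)).mul
      (((ha i).pow_const _).comp measurable_fst))
      (fun z => (mul_bd _ _ (hf0 _) (hfB _) (hab i _).1 (hab i _).2).1)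
      (fun z => (mul_bd _ _ (hf0 _) (hfB _) (hab i _).1 (hab i _).2).2)
    rw [integral_prod _ h4]
    refine integral_congr_ae (ae_of_all _ fun x => ?_)
    simp only [integral_mul_const]
    exact hpow _ (hab i x).1
  have e2 : ∫ x, breg p (f x) (a i x) ∂ν = ∫ x, f x ^ p ∂ν - ∫ x, f x * a i x ^ (p - 1) ∂ν := by
    unfold breg
    have hA : Integrable (fun x => (p - 1) * a i x ^ p) ν := iap.const_mul _
    have hAB : Integrable (fun x => f x ^ p + (p - 1) * a i x ^ p) ν := ifp.add hA
    rw [integral_sub hAB (ifa.const_mul p), integral_add ifp hA, integral_const_mul,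
      integral_const_mul, e1]
    ring
  have iprod : Integrable (fun z => f z.1 * f (resample i z) ^ (p - 1)) (ν.prod ν) :=
    integrable_of_bounds ((hf.comp measurable_fst).mul
      ((hf.comp (measurable_resample i)).pow_const _))
      (fun z => (mul_bd _ _ (hf0 _) (hfB _) (hf0 _) (hfB _)).1)
      (fun z => (mul_bd _ _ (hf0 _) (hfB _) (hf0 _) (hfB _)).2)
  have e3 : ∫ z, f z.1 * f (resample i z) ^ (p - 1) ∂ν.prod ν ≤ ∫ x, f x * a i x ^ (p - 1) ∂ν := by
    rw [integral_prod _ iprod]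
    refine integral_mono iprod.integral_prod_left ifa fun x => ?_
    simp only [integral_const_mul]
    refine mul_le_mul_of_nonneg_left ?_ (hf0 x)
    have := (Real.concaveOn_rpow hp1.le (by linarith)).le_map_integral (μ := ν)
      (f := fun x' => f (resample i (x, x')))
      (Real.continuous_rpow_const hp1.le).continuousOn isClosed_Ici (ae_of_all _ fun _ => hf0 _)
      (integrable_of_bounds (hf.comp (hr i x)) (fun _ => hf0 _) (fun _ => hfB _))
      (integrable_rpow (hf.comp (hr i x)) hp1.le (fun _ => hf0 _) (fun _ => hfB _))
    exact this
  have e4 : ∫ z, f z.1 * (f z.1 ^ (p - 1) - f (resample i z) ^ (p - 1)) ∂ν.prod ν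
      = ∫ x, f x ^ p ∂ν - ∫ z, f z.1 * f (resample i z) ^ (p - 1) ∂ν.prod ν := by
    have h1 : ∀ z : (Fin n → 𝒳) × (Fin n → 𝒳), f z.1 * (f z.1 ^ (p - 1) - f (resample i z) ^ (p - 1))
      = f z.1 ^ p - f z.1 * f (resample i z) ^ (p - 1) := fun z => by
        rw [hpow _ (hf0 z.1)]; ring
    simp only [h1]
    have h2 : Integrable (fun z : (Fin n → 𝒳) × (Fin n → 𝒳) => f z.1 ^ p) (ν.prod ν) :=
      integrable_rpow (hf.comp measurable_fst) (by linarith) (fun _ => hf0 _) (fun _ => hfB _)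
    rw [integral_sub h2 iprod]
    have := integral_fun_fst (μ := ν) (ν := ν) (fun x => f x ^ p)
    simp only [probReal_univ, one_smul] at this
    rw [this]
  rw [e2, e4]
  linarith

/-- Symmetrized subadditivity: only the event `F (resample i z) < F z.1` contributes. -/
lemma entropy_le_resample_symm (μ : Fin n → Measure 𝒳) [∀ i, IsProbabilityMeasure (μ i)] {p : ℝ}
    (hp : 1 < p) (hp2 : p ≤ 2) {f F : (Fin n → 𝒳) → ℝ} (hf : Measurable f) (hF : Measurable F)
    {B : ℝ} (hf0 : ∀ x, 0 ≤ f x) (hfB : ∀ x, f x ≤ B) (hfF : ∀ x y, F x = F y → f x = f y) :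
    ∫ x, f x ^ p ∂Measure.pi μ - (∫ x, f x ∂Measure.pi μ) ^ p ≤
      ∑ i, ∫ z, (if F (resample i z) < F z.1 then
        (f z.1 - f (resample i z)) * (f z.1 ^ (p - 1) - f (resample i z) ^ (p - 1)) else 0)
        ∂(Measure.pi μ).prod (Measure.pi μ) := by
  refine (entropy_le_resample μ hp hp2 hf hf0 hfB).trans_eq (Finset.sum_congr rfl fun i _ => ?_)
  set ν := Measure.pi μ
  have hp1 : 0 < p - 1 := by linarith
  set s : (Fin n → 𝒳) → (Fin n → 𝒳) → ℝ := fun x y => f x * (f x ^ (p - 1) - f y ^ (p - 1))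
  have hms : Measurable fun z : (Fin n → 𝒳) × (Fin n → 𝒳) => s z.1 (resample i z) :=
    (hf.comp measurable_fst).mul (((hf.comp measurable_fst).pow_const _).sub
      ((hf.comp (measurable_resample i)).pow_const _))
  have hms' : Measurable fun z : (Fin n → 𝒳) × (Fin n → 𝒳) => s (resample i z) z.1 :=
    (hf.comp (measurable_resample i)).mul (((hf.comp (measurable_resample i)).pow_const _).sub
      ((hf.comp measurable_fst).pow_const _))
  have hsb : ∀ x y, |s x y| ≤ B * B ^ (p - 1) := fun x y => by
    have h1 := Real.rpow_nonneg (hf0 x) (p - 1)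
    have h2 := Real.rpow_nonneg (hf0 y) (p - 1)
    have h3 := Real.rpow_le_rpow (hf0 x) (hfB x) hp1.le
    have h4 := Real.rpow_le_rpow (hf0 y) (hfB y) hp1.le
    rw [abs_mul, abs_of_nonneg (hf0 x)]
    refine mul_le_mul (hfB x) ?_ (abs_nonneg _) ((hf0 x).trans (hfB x))
    rw [abs_le]; constructor <;> linarith
  have hA : MeasurableSet {z : (Fin n → 𝒳) × (Fin n → 𝒳) | F (resample i z) < F z.1} :=
    measurableSet_lt (hF.comp (measurable_resample i)) (hF.comp measurable_fst)
  have hA' : MeasurableSet {z : (Fin n → 𝒳) × (Fin n → 𝒳) | F z.1 < F (resample i z)} :=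
    measurableSet_lt (hF.comp measurable_fst) (hF.comp (measurable_resample i))
  have hB0 : 0 ≤ B * B ^ (p - 1) := (abs_nonneg _).trans (hsb (fun i => (Classical.choice
    (μ i).nonempty_of_neZero)) (fun i => (Classical.choice (μ i).nonempty_of_neZero)))
  have hite : ∀ (P : Prop) [Decidable P] (x y : Fin n → 𝒳),
      |if P then s x y else 0| ≤ B * B ^ (p - 1) := fun P _ x y => by
    split_ifs
    · exact hsb x y
    · simpa using hB0
  have m1 : Measurable fun z : (Fin n → 𝒳) × (Fin n → 𝒳) =>
      if F (resample i z) < F z.1 then s z.1 (resample i z) else 0 := Measurable.ite hA hms measurable_const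
  have m2 : Measurable fun z : (Fin n → 𝒳) × (Fin n → 𝒳) =>
      if F z.1 < F (resample i z) then s z.1 (resample i z) else 0 := Measurable.ite hA' hms measurable_const
  have m3 : Measurable fun z : (Fin n → 𝒳) × (Fin n → 𝒳) =>
      if F (resample i z) < F z.1 then s (resample i z) z.1 else 0 := Measurable.ite hA hms' measurable_const
  have i1 : Integrable (fun z => if F (resample i z) < F z.1 then s z.1 (resample i z) else 0)
      (ν.prod ν) := integrable_of_abs_le m1 (fun z => hite _ _ _)
  have i2 : Integrable (fun z => if F z.1 < F (resample i z) then s z.1 (resample i z) else 0)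
      (ν.prod ν) := integrable_of_abs_le m2 (fun z => hite _ _ _)
  have i3 : Integrable (fun z => if F (resample i z) < F z.1 then s (resample i z) z.1 else 0)
      (ν.prod ν) := integrable_of_abs_le m3 (fun z => hite _ _ _)
  -- Ties contribute nothing because f depends on x only through F x. The case where resampling
  -- raises F is carried onto the opposite one by the exchange of coordinates.
  have e1 : ∫ z, s z.1 (resample i z) ∂ν.prod ν =
      ∫ z, (if F (resample i z) < F z.1 then s z.1 (resample i z) else 0) ∂ν.prod ν
      + ∫ z, (if F z.1 < F (resample i z) then s z.1 (resample i z) else 0) ∂ν.prod ν := by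
    rw [← integral_add i1 i2]
    refine integral_congr_ae (ae_of_all _ fun z => ?_)
    simp only
    rcases lt_trichotomy (F (resample i z)) (F z.1) with h | h | h
    · simp [h, h.not_gt]
    · have := hfF _ _ h
      simp [h, s, this]
    · simp [h, h.not_gt]
  have e2 : ∫ z, (if F z.1 < F (resample i z) then s z.1 (resample i z) else 0) ∂ν.prod ν
      = ∫ z, (if F (resample i z) < F z.1 then s (resample i z) z.1 else 0) ∂ν.prod ν := by
    rw [← integral_exchange μ i m2]
    simp [ν]
  have e3 : ∀ z : (Fin n → 𝒳) × (Fin n → 𝒳), f z.1 * (f z.1 ^ (p - 1) - f (resample i z) ^ (p - 1))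
      = s z.1 (resample i z) := fun z => rfl
  simp only [e3]
  rw [e1, e2, ← integral_add i1 i3]
  refine integral_congr_ae (ae_of_all _ fun z => ?_)
  simp only
  split_ifs
  · simp only [s]; ring
  · simp

end Resample

/-! ### Real-valued `L^q` norms of bounded nonnegative functions -/

section Norm

variable {α β : Type*} [MeasurableSpace α] [MeasurableSpace β] {f g : α → ℝ}

/-- Bounded measurable nonnegative functions. -/
structure Bdd (f : α → ℝ) : Prop where
  meas : Measurable f
  nonneg : ∀ x, 0 ≤ f x
  bdd : ∃ B, ∀ x, f x ≤ B

namespace Bdd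

lemma exists_bound (hf : Bdd f) : ∃ B, 0 ≤ B ∧ ∀ x, f x ≤ B := by
  obtain ⟨B, hB⟩ := hf.bdd
  exact ⟨max B 0, le_max_right _ _, fun x => (hB x).trans (le_max_left _ _)⟩

lemma const {c : ℝ} (hc : 0 ≤ c) : Bdd fun _ : α => c :=
  ⟨measurable_const, fun _ => hc, c, fun _ => le_rfl⟩

lemma of_le (hg : Bdd g) (hf : Measurable f) (h0 : ∀ x, 0 ≤ f x) (h : ∀ x, f x ≤ g x) : Bdd f :=
  ⟨hf, h0, hg.bdd.choose, fun x => (h x).trans (hg.bdd.choose_spec x)⟩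

lemma add (hf : Bdd f) (hg : Bdd g) : Bdd fun x => f x + g x := by
  obtain ⟨B, hB⟩ := hf.bdd
  obtain ⟨C, hC⟩ := hg.bdd
  exact ⟨hf.meas.add hg.meas, fun x => add_nonneg (hf.nonneg x) (hg.nonneg x), B + C,
    fun x => add_le_add (hB x) (hC x)⟩

lemma mul (hf : Bdd f) (hg : Bdd g) : Bdd fun x => f x * g x := by
  obtain ⟨B, hB0, hB⟩ := hf.exists_bound
  obtain ⟨C, hC0, hC⟩ := hg.exists_bound
  exact ⟨hf.meas.mul hg.meas, fun x => mul_nonneg (hf.nonneg x) (hg.nonneg x), B * C,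
    fun x => mul_le_mul (hB x) (hC x) (hg.nonneg x) hB0⟩

lemma rpow (hf : Bdd f) {p : ℝ} (hp : 0 ≤ p) : Bdd fun x => f x ^ p := by
  obtain ⟨B, hB0, hB⟩ := hf.exists_bound
  exact ⟨hf.meas.pow_const p, fun x => Real.rpow_nonneg (hf.nonneg x) _, B ^ p,
    fun x => Real.rpow_le_rpow (hf.nonneg x) (hB x) hp⟩

lemma sq (hf : Bdd f) : Bdd fun x => f x ^ 2 := by
  simpa [pow_two] using hf.mul hf

lemma const_mul (hf : Bdd f) {c : ℝ} (hc : 0 ≤ c) : Bdd fun x => c * f x := (Bdd.const hc).mul hf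

lemma sum {ι : Type*} {s : Finset ι} {f : ι → α → ℝ} (hf : ∀ i, Bdd (f i)) :
    Bdd fun x => ∑ i ∈ s, f i x := by
  classical
  induction s using Finset.induction_on with
  | empty => simpa using Bdd.const le_rfl
  | insert i s hi ih => simpa [Finset.sum_insert hi] using (hf i).add ih

lemma comp (hf : Bdd f) {k : β → α} (hk : Measurable k) : Bdd fun x => f (k x) :=
  ⟨hf.meas.comp hk, fun _ => hf.nonneg _, hf.bdd.choose, fun _ => hf.bdd.choose_spec _⟩

lemma integrable (hf : Bdd f) {μ : Measure α} [IsFiniteMeasure μ] : Integrable f μ :=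
  integrable_of_bounds hf.meas hf.nonneg hf.bdd.choose_spec

lemma integral_right {f : α × β → ℝ} (hf : Bdd f) {μ : Measure β} [IsProbabilityMeasure μ] :
    Bdd fun x => ∫ y, f (x, y) ∂μ := by
  obtain ⟨B, hB⟩ := hf.bdd
  have h := fun x => integral_nonneg_le (μ := μ) (hf.meas.comp (measurable_prodMk_left (x := x)))
    (fun _ => hf.nonneg _) (fun _ => hB _)
  exact ⟨hf.meas.stronglyMeasurable.integral_prod_right'.measurable, fun x => (h x).1, B,
    fun x => (h x).2⟩

end Bdd

/-- The `L^q` norm of a nonnegative function. -/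
def rnorm (μ : Measure α) (q : ℝ) (f : α → ℝ) : ℝ := (∫ x, f x ^ q ∂μ) ^ (1 / q)

variable {μ : Measure α}

lemma rnorm_nonneg {q : ℝ} (hf : Bdd f) : 0 ≤ rnorm μ q f :=
  Real.rpow_nonneg (integral_nonneg fun x => Real.rpow_nonneg (hf.nonneg x) _) _

lemma rnorm_rpow {q : ℝ} (hq : 0 < q) (hf : Bdd f) : rnorm μ q f ^ q = ∫ x, f x ^ q ∂μ := by
  unfold rnorm
  rw [← Real.rpow_mul (integral_nonneg fun x => Real.rpow_nonneg (hf.nonneg x) _),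
    one_div_mul_cancel hq.ne', Real.rpow_one]

lemma eLpNorm_eq_rnorm [IsFiniteMeasure μ] {q : ℝ} (hq : 0 < q) (hf : Bdd f) :
    eLpNorm f (ENNReal.ofReal q) μ = ENNReal.ofReal (rnorm μ q f) := by
  obtain ⟨B, hB⟩ := hf.bdd
  have hL : MemLp f (ENNReal.ofReal q) μ := MemLp.of_bound hf.meas.aestronglyMeasurable B
    (ae_of_all _ fun x => by rw [Real.norm_eq_abs, abs_of_nonneg (hf.nonneg x)]; exact hB x)
  rw [hL.eLpNorm_eq_integral_rpow_norm (by simpa using hq) ENNReal.ofReal_ne_top,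
    ENNReal.toReal_ofReal hq.le, rnorm, one_div]
  simp only [Real.norm_eq_abs, abs_of_nonneg (hf.nonneg _)]

lemma rnorm_mono_exponent [IsProbabilityMeasure μ] {p q : ℝ} (hp : 0 < p) (hpq : p ≤ q)
    (hf : Bdd f) : rnorm μ p f ≤ rnorm μ q f := by
  have h := eLpNorm_le_eLpNorm_of_exponent_le (μ := μ) (ENNReal.ofReal_le_ofReal hpq)
    hf.meas.aestronglyMeasurable
  rw [eLpNorm_eq_rnorm hp hf, eLpNorm_eq_rnorm (hp.trans_le hpq) hf] at h
  exact (ENNReal.ofReal_le_ofReal_iff (rnorm_nonneg hf)).1 h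

lemma rnorm_add_le [IsProbabilityMeasure μ] {q : ℝ} (hq : 1 ≤ q) (hf : Bdd f) (hg : Bdd g) :
    rnorm μ q (fun x => f x + g x) ≤ rnorm μ q f + rnorm μ q g := by
  have hq0 : 0 < q := by linarith
  have h := eLpNorm_add_le (μ := μ) (p := ENNReal.ofReal q) hf.meas.aestronglyMeasurable
    hg.meas.aestronglyMeasurable (by simpa using hq)
  rw [show f + g = fun x => f x + g x from rfl, eLpNorm_eq_rnorm hq0 hf, eLpNorm_eq_rnorm hq0 hg,
    eLpNorm_eq_rnorm hq0 (hf.add hg), ← ENNReal.ofReal_add (rnorm_nonneg hf) (rnorm_nonneg hg)] at h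
  exact (ENNReal.ofReal_le_ofReal_iff (add_nonneg (rnorm_nonneg hf) (rnorm_nonneg hg))).1 h

lemma rnorm_sq [IsProbabilityMeasure μ] {q : ℝ} (hq : 0 < q) (hf : Bdd f) :
    rnorm μ (q / 2) (fun x => f x ^ 2) = rnorm μ q f ^ 2 := by
  unfold rnorm
  have h : ∀ x, (f x ^ 2) ^ (q / 2) = f x ^ q := fun x => by
    rw [← Real.rpow_natCast, ← Real.rpow_mul (hf.nonneg x)]; congr 1; push_cast; ring
  simp only [h]
  rw [← Real.rpow_natCast (_ ^ (1 / q)),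
    ← Real.rpow_mul (integral_nonneg fun x => Real.rpow_nonneg (hf.nonneg x) _)]
  congr 1; push_cast; field_simp

/-- Hölder's inequality with exponents `q / 2` and `q / (q - 2)`. -/
lemma integral_mul_rpow_le [IsProbabilityMeasure μ] {q : ℝ} (hq : 2 ≤ q) (hf : Bdd f) (hg : Bdd g) :
    ∫ x, f x * g x ^ (q - 2) ∂μ ≤ rnorm μ (q / 2) f * rnorm μ q g ^ (q - 2) := by
  rcases eq_or_lt_of_le hq with rfl | hq
  · simp [rnorm]
  · have hc : (q / 2).HolderConjugate (q / (q - 2)) := by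
      rw [Real.holderConjugate_iff]
      have : q - 2 ≠ 0 := by linarith
      refine ⟨by linarith, ?_⟩
      field_simp; ring
    have hmem : ∀ {k : α → ℝ} (p : ℝ), Bdd k → MemLp k (ENNReal.ofReal p) μ := fun {k} p hk =>
      MemLp.of_bound hk.meas.aestronglyMeasurable hk.bdd.choose
        (ae_of_all _ fun x => by
          rw [Real.norm_eq_abs, abs_of_nonneg (hk.nonneg x)]; exact hk.bdd.choose_spec x)
    have hgp : Bdd fun x => g x ^ (q - 2) := hg.rpow (by linarith)
    have h := integral_mul_le_Lp_mul_Lq_of_nonneg (μ := μ) hc (ae_of_all _ hf.nonneg)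
      (ae_of_all _ hgp.nonneg) (hmem _ hf) (hmem _ hgp)
    refine h.trans_eq ?_
    have e : ∀ x, (g x ^ (q - 2)) ^ (q / (q - 2)) = g x ^ q := fun x => by
      have : q - 2 ≠ 0 := by linarith
      rw [← Real.rpow_mul (hg.nonneg x)]; congr 1; field_simp
    simp only [e]
    unfold rnorm
    rw [← Real.rpow_mul (integral_nonneg fun x => Real.rpow_nonneg (hg.nonneg x) _)]
    congr 2
    have : q - 2 ≠ 0 := by linarith
    field_simp

lemma rnorm_prod_fst {ν : Measure β} [IsProbabilityMeasure ν] [SFinite μ] (q : ℝ) (f : α → ℝ) :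
    rnorm (μ.prod ν) q (fun z => f z.1) = rnorm μ q f := by
  unfold rnorm
  have := integral_fun_fst (μ := μ) (ν := ν) (fun x => f x ^ q)
  simp only [probReal_univ, one_smul] at this
  rw [this]

end Norm

/-! ### Decoupling -/

section Decouple

variable {𝒳 : Type*} [MeasurableSpace 𝒳] {n : ℕ}

lemma integral_eval (μ : Fin n → Measure 𝒳) [∀ i, IsProbabilityMeasure (μ i)] (i : Fin n)
    {k : 𝒳 → ℝ} (hk : Measurable k) : ∫ x, k (x i) ∂Measure.pi μ = ∫ w, k w ∂μ i := by
  have h := measurePreserving_eval μ i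
  conv_rhs => rw [← h.map_eq]
  rw [integral_map h.measurable.aemeasurable hk.aestronglyMeasurable]

/-- A sum of independent nonnegative variables weighted by a monotone function of themselves,
compared with a common upper bound `M` of them that is at most `T` with probability `4 / 5`. -/
lemma decouple (μ : Fin n → Measure 𝒳) [∀ i, IsProbabilityMeasure (μ i)] {y : Fin n → 𝒳 → ℝ}
    (hy : ∀ i, Bdd (y i)) {h : ℝ → ℝ} (hh : Measurable h) (hmono : MonotoneOn h (Set.Ici 0))
    (h0 : ∀ t, 0 ≤ t → 0 ≤ h t) {M : (Fin n → 𝒳) → ℝ} (hM : Bdd M) (hyM : ∀ i x, y i (x i) ≤ M x)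
    {T : ℝ} (hT0 : 0 ≤ T) (hT : 4 / 5 ≤ (Measure.pi μ).real {x | ∀ i, y i (x i) ≤ T}) :
    ∫ x, ∑ i, y i (x i) ^ 2 * h (y i (x i)) ∂Measure.pi μ ≤
      h T * ∫ x, ∑ i, y i (x i) ^ 2 ∂Measure.pi μ
        + 5 / 4 * ∫ x, M x ^ 2 * h (M x) ∂Measure.pi μ := by
  classical
  set ν := Measure.pi μ
  have hhb : ∀ {α : Type _} [MeasurableSpace α] {k : α → ℝ}, Bdd k → Bdd fun x => h (k x) := by
    intro α _ k hk
    obtain ⟨B, hB0, hB⟩ := hk.exists_bound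
    exact ⟨hh.comp hk.meas, fun x => h0 _ (hk.nonneg x), h B,
      fun x => hmono (hk.nonneg x) hB0 (hB x)⟩
  set e : Fin n → 𝒳 → ℝ := fun i w => if T < y i w then y i w ^ 2 * h (y i w) else 0 with he_def
  set k : Fin n → 𝒳 → ℝ := fun i w => if y i w ≤ T then 1 else 0 with hk_def
  have hH : ∀ i, Bdd fun w => y i w ^ 2 * h (y i w) := fun i => (hy i).sq.mul (hhb (hy i))
  have he : ∀ i, Bdd (e i) := fun i => (hH i).of_le
    (Measurable.ite (measurableSet_lt measurable_const (hy i).meas) (hH i).meas measurable_const)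
    (fun w => by simp only [he_def]; split_ifs; exacts [(hH i).nonneg w, le_rfl])
    (fun w => by simp only [he_def]; split_ifs; exacts [le_rfl, (hH i).nonneg w])
  have hk01 : ∀ i w, 0 ≤ k i w ∧ k i w ≤ 1 := fun i w => by
    simp only [hk_def]; split_ifs <;> norm_num
  have hk : ∀ i, Bdd (k i) := fun i => ⟨Measurable.ite (measurableSet_le (hy i).meas
    measurable_const) measurable_const measurable_const, fun w => (hk01 i w).1, 1,
    fun w => (hk01 i w).2⟩
  have hprodk : 4 / 5 ≤ ∏ i, ∫ w, k i w ∂μ i := by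
    rw [← integral_fintype_prod_eq_prod]
    refine hT.trans_eq ?_
    have hms : MeasurableSet {x : Fin n → 𝒳 | ∀ i, y i (x i) ≤ T} := by
      rw [Set.ofPred_forall]
      exact MeasurableSet.iInter fun i =>
        measurableSet_le ((hy i).meas.comp (measurable_pi_apply i)) measurable_const
    rw [← integral_indicator_one hms]
    refine integral_congr_ae (ae_of_all _ fun x => ?_)
    simp only [hk_def, Set.indicator_apply, Set.mem_ofPred_eq, Pi.one_apply]
    rw [Fintype.prod_ite_zero]
    simp
  have hk_int : ∀ i, 0 ≤ ∫ w, k i w ∂μ i ∧ ∫ w, k i w ∂μ i ≤ 1 := fun i =>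
    integral_nonneg_le (hk i).meas (fun w => (hk01 i w).1) (fun w => (hk01 i w).2)
  -- Dropping a factor that is at most 1 does not decrease the product.
  have hpe : ∀ i, 4 / 5 ≤ ∏ j ∈ Finset.univ.erase i, ∫ w, k j w ∂μ j := fun i => by
    have h1 := Finset.mul_prod_erase Finset.univ (fun j => ∫ w, k j w ∂μ j) (Finset.mem_univ i)
    have h2 : 0 ≤ ∏ j ∈ Finset.univ.erase i, ∫ w, k j w ∂μ j :=
      Finset.prod_nonneg fun j _ => (hk_int j).1
    have := mul_le_mul_of_nonneg_right (hk_int i).2 h2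
    linarith
  have hupd : ∀ i (x : Fin n → 𝒳), ∏ j, Function.update k i (e i) j (x j)
      = e i (x i) * ∏ j ∈ Finset.univ.erase i, k j (x j) := fun i x => by
    rw [← Finset.mul_prod_erase Finset.univ _ (Finset.mem_univ i), Function.update_self]
    congr 1
    exact Finset.prod_congr rfl fun j hj => by rw [Function.update_of_ne (Finset.ne_of_mem_erase hj)]
  have hbupd : ∀ i, Bdd fun x : Fin n → 𝒳 => e i (x i) * ∏ j ∈ Finset.univ.erase i, k j (x j) :=
    fun i => ((he i).comp (measurable_pi_apply i)).mul
      ⟨Finset.measurable_prod _ fun j _ => (hk j).meas.comp (measurable_pi_apply j),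
        fun x => Finset.prod_nonneg fun j _ => (hk01 j _).1, 1,
        fun x => Finset.prod_le_one (fun j _ => (hk01 j _).1) (fun j _ => (hk01 j _).2)⟩
  -- By independence the integral of e_i ∏_{j ≠ i} k_j factorizes, and the second factor is at least
  -- 4/5.
  have h1 : ∀ i, ∫ w, e i w ∂μ i ≤
      5 / 4 * ∫ x, e i (x i) * ∏ j ∈ Finset.univ.erase i, k j (x j) ∂ν := fun i => by
    simp only [← hupd]
    rw [integral_fintype_prod_eq_prod, ← Finset.mul_prod_erase Finset.univ _ (Finset.mem_univ i),
      Function.update_self]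
    have : ∏ j ∈ Finset.univ.erase i, ∫ w, Function.update k i (e i) j w ∂μ j
        = ∏ j ∈ Finset.univ.erase i, ∫ w, k j w ∂μ j :=
      Finset.prod_congr rfl fun j hj => by rw [Function.update_of_ne (Finset.ne_of_mem_erase hj)]
    rw [this]
    have h2 := mul_le_mul_of_nonneg_left (hpe i) (integral_nonneg (μ := μ i) (he i).nonneg)
    have h3 : 0 ≤ ∫ w, e i w ∂μ i := integral_nonneg (he i).nonneg
    linarith
  have hMH : Bdd fun x => M x ^ 2 * h (M x) := hM.sq.mul (hhb hM)
  have hHmono : ∀ s t, 0 ≤ s → s ≤ t → s ^ 2 * h s ≤ t ^ 2 * h t := fun s t hs hst =>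
    mul_le_mul (by gcongr) (hmono hs (hs.trans hst) hst) (h0 s hs) (by positivity)
  -- If y i exceeds T, every other summand contains the factor k i = 0. So at most one summand
  -- survives at each point, and it is at most M² h(M).
  have h2 : ∑ i, ∫ x, e i (x i) * ∏ j ∈ Finset.univ.erase i, k j (x j) ∂ν ≤
      ∫ x, M x ^ 2 * h (M x) ∂ν := by
    rw [← integral_finsetSum _ fun i _ => (hbupd i).integrable]
    refine integral_mono (Bdd.sum hbupd).integrable hMH.integrable fun x => ?_
    simp only
    by_cases hex : ∃ i, T < y i (x i)
    · obtain ⟨i, hi⟩ := hex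
      rw [Finset.sum_eq_single i]
      · have h3 : ∏ j ∈ Finset.univ.erase i, k j (x j) ≤ 1 :=
          Finset.prod_le_one (fun j _ => (hk01 j _).1) (fun j _ => (hk01 j _).2)
        calc e i (x i) * ∏ j ∈ Finset.univ.erase i, k j (x j) ≤ e i (x i) * 1 :=
              mul_le_mul_of_nonneg_left h3 ((he i).nonneg _)
          _ = y i (x i) ^ 2 * h (y i (x i)) := by simp [he_def, hi]
          _ ≤ _ := hHmono _ _ ((hy i).nonneg _) (hyM i x)
      · intro j _ hj
        rw [Finset.prod_eq_zero (i := i) (Finset.mem_erase.2 ⟨hj.symm, Finset.mem_univ _⟩)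
          (by simp [hk_def, hi]), mul_zero]
      · simp
    · push Not at hex
      refine (Finset.sum_nonpos fun i _ => ?_).trans (hMH.nonneg x)
      simp [he_def, (hex i).not_gt]
  have hyx : ∀ i, Bdd fun x : Fin n → 𝒳 => y i (x i) := fun i => (hy i).comp (measurable_pi_apply i)
  have hex : ∀ i, Bdd fun x : Fin n → 𝒳 => e i (x i) := fun i => (he i).comp (measurable_pi_apply i)
  have h3 : ∫ x, ∑ i, y i (x i) ^ 2 * h (y i (x i)) ∂ν ≤
      ∫ x, (h T * ∑ i, y i (x i) ^ 2 + ∑ i, e i (x i)) ∂ν := by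
    refine integral_mono (Bdd.sum fun i => (hyx i).sq.mul (hhb (hyx i))).integrable
      (((Bdd.sum fun i => (hyx i).sq).const_mul (h0 T hT0)).add (Bdd.sum hex)).integrable fun x => ?_
    simp only
    rw [Finset.mul_sum, ← Finset.sum_add_distrib]
    refine Finset.sum_le_sum fun i _ => ?_
    simp only [he_def]
    split_ifs with hlt
    · have := mul_nonneg (h0 T hT0) (sq_nonneg (y i (x i)))
      linarith
    · have := mul_le_mul_of_nonneg_left (hmono ((hy i).nonneg (x i)) hT0 (not_lt.1 hlt))
        (sq_nonneg (y i (x i)))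
      linarith
  have h4 : ∫ x, (h T * ∑ i, y i (x i) ^ 2 + ∑ i, e i (x i)) ∂ν =
      h T * ∫ x, ∑ i, y i (x i) ^ 2 ∂ν + ∑ i, ∫ w, e i w ∂μ i := by
    rw [integral_add ((Bdd.sum fun i => (hyx i).sq).const_mul (h0 T hT0)).integrable
      (Bdd.sum hex).integrable, integral_const_mul, integral_finsetSum _ fun i _ => (hex i).integrable]
    congr 1
    exact Finset.sum_congr rfl fun i _ => integral_eval μ i (he i).meas
  have h5 := Finset.sum_le_sum (s := Finset.univ) fun i _ => h1 i
  rw [← Finset.mul_sum] at h5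
  linarith

/-- A Markov inequality for the level `(5 ∫ M ^ q) ^ (1 / q)`. -/
lemma prob_le_level {α : Type*} [MeasurableSpace α] {μ : Measure α} [IsProbabilityMeasure μ]
    {M : α → ℝ} (hM : Bdd M) {q : ℝ} (hq : 0 < q) :
    4 / 5 ≤ μ.real {x | M x ≤ (5 * ∫ x, M x ^ q ∂μ) ^ (1 / q)} := by
  set I := ∫ x, M x ^ q ∂μ with hI
  have hI0 : 0 ≤ I := integral_nonneg fun x => Real.rpow_nonneg (hM.nonneg x) _
  have hms : MeasurableSet {x | M x ≤ (5 * I) ^ (1 / q)} :=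
    measurableSet_le hM.meas measurable_const
  have hc := probReal_compl_eq_one_sub (μ := μ) hms
  have hlt : μ.real {x | M x ≤ (5 * I) ^ (1 / q)}ᶜ ≤ 1 / 5 := by
    -- Markov's inequality at level 5 I says nothing when I = 0; in that case M = 0 almost
    -- everywhere.
    rcases eq_or_lt_of_le hI0 with h | h
    · have h1 := (integral_eq_zero_iff_of_nonneg (fun x => (hM.rpow hq.le).nonneg x)
        (hM.rpow hq.le).integrable).1 (hI ▸ h.symm)
      have h2 : ∀ᵐ x ∂μ, x ∈ {x | M x ≤ (5 * I) ^ (1 / q)} := by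
        filter_upwards [h1] with x hx
        simp only [Pi.zero_apply] at hx
        rw [Real.rpow_eq_zero (hM.nonneg x) hq.ne'] at hx
        rw [hx]; positivity
      have : μ {x | M x ≤ (5 * I) ^ (1 / q)}ᶜ = 0 := h2
      rw [measureReal_def, this]; norm_num
    · have h1 := mul_meas_ge_le_integral_of_nonneg (μ := μ) (ae_of_all _ (hM.rpow hq.le).nonneg)
        (hM.rpow hq.le).integrable (5 * I)
      have h2 : μ.real {x | M x ≤ (5 * I) ^ (1 / q)}ᶜ ≤ μ.real {x | 5 * I ≤ M x ^ q} := by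
        refine measureReal_mono fun x hx => ?_
        simp only [Set.mem_compl_iff, Set.mem_ofPred_eq, not_le] at hx ⊢
        have := Real.rpow_le_rpow (by positivity) hx.le hq.le
        rwa [← Real.rpow_mul (by positivity), one_div_mul_cancel hq.ne', Real.rpow_one] at this
      have h3 : 5 * I * μ.real {x | 5 * I ≤ M x ^ q} ≤ I := h1
      have h4 : μ.real {x | 5 * I ≤ M x ^ q} ≤ 1 / 5 := by
        by_contra hcon
        push Not at hcon
        nlinarith
      linarith
  linarith

end Decouple

/-! ### Moment recursions for the lower deviation -/

section Recursion

variable {𝒳 : Type*} {n : ℕ}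

lemma Bdd.iSup {α : Type*} [MeasurableSpace α] {f : Fin n → α → ℝ} (hf : ∀ i, Bdd (f i)) :
    Bdd fun x => ⨆ i, f i x := by
  choose B hB0 hB using fun i => (hf i).exists_bound
  refine ⟨Measurable.iSup fun i => (hf i).meas, fun x => Real.iSup_nonneg fun i => (hf i).nonneg x,
    ∑ i, B i, fun x => ?_⟩
  refine Real.iSup_le (fun i => (hB i x).trans ?_) (Finset.sum_nonneg fun i _ => hB0 i)
  exact Finset.single_le_sum (fun i _ => hB0 i) (Finset.mem_univ i)

lemma le_iSup_fin {f : Fin n → ℝ} (i : Fin n) : f i ≤ ⨆ j, f j :=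
  le_ciSup (Set.finite_range f).bddAbove i

/-- The lower deviation `(F - c)₋`. -/
def lowerDev {α : Type*} (F : α → ℝ) (c : ℝ) (x : α) : ℝ := (F x - c)⁻

lemma lowerDev_eq {α : Type*} (F : α → ℝ) (c : ℝ) (x : α) :
    lowerDev F c x = max (c - F x) 0 := by
  unfold lowerDev; rw [negPart_def, neg_sub]

lemma Bdd.lowerDev {α : Type*} [MeasurableSpace α] {F : α → ℝ} (hF : Bdd F) (c : ℝ) :
    Bdd (lowerDev F c) := by
  have : MomentIneq.lowerDev F c = fun x => max (c - F x) 0 := funext (lowerDev_eq F c)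
  rw [this]
  exact ⟨(measurable_const.sub hF.meas).max measurable_const, fun x => le_max_right _ _,
    max c 0, fun x => max_le_max (by linarith [hF.nonneg x]) le_rfl⟩

lemma lowerDev_anti {α : Type*} {F : α → ℝ} (c : ℝ) {x y : α} (h : F x ≤ F y) :
    lowerDev F c y ≤ lowerDev F c x := by
  rw [lowerDev_eq, lowerDev_eq]; exact max_le_max (by linarith) le_rfl

/-- The upper increment `(F(x) - F(x^{(i)}))₊` under resampling of the `i`-th coordinate. -/
def upInc (F : (Fin n → 𝒳) → ℝ) (i : Fin n) (z : (Fin n → 𝒳) × (Fin n → 𝒳)) : ℝ :=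
  (F z.1 - F (resample i z))⁺

lemma lowerDev_resample_le (F : (Fin n → 𝒳) → ℝ) (c : ℝ) (i : Fin n)
    (z : (Fin n → 𝒳) × (Fin n → 𝒳)) :
    lowerDev F c (resample i z) ≤ lowerDev F c z.1 + upInc F i z := by
  rw [lowerDev_eq, lowerDev_eq]
  have h1 : F z.1 - F (resample i z) ≤ upInc F i z := le_posPart _
  have h2 : 0 ≤ upInc F i z := posPart_nonneg _
  have h3 := le_max_left (c - F z.1) 0
  have h4 := le_max_right (c - F z.1) 0
  exact max_le (by linarith) (by linarith)

variable [MeasurableSpace 𝒳]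

lemma Bdd.upInc {F : (Fin n → 𝒳) → ℝ} (hF : Bdd F) (i : Fin n) : Bdd (upInc F i) :=
  (hF.comp measurable_fst).of_le
    (((hF.meas.comp measurable_fst).sub (hF.meas.comp (measurable_resample i))).max
      measurable_const) (fun _ => posPart_nonneg _)
    (fun z => max_le (by linarith [hF.nonneg (resample i z)]) (hF.nonneg _))

/-- The conditional variance proxy `∫ ∑ᵢ (F(x) - F(x^{(i)}))₊²`. -/
def upVar (μ : Fin n → Measure 𝒳) (F : (Fin n → 𝒳) → ℝ) (x : Fin n → 𝒳) : ℝ :=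
  ∫ x', ∑ i, upInc F i (x, x') ^ 2 ∂Measure.pi μ

/-- The largest upper increment. -/
def maxInc (F : (Fin n → 𝒳) → ℝ) (z : (Fin n → 𝒳) × (Fin n → 𝒳)) : ℝ := ⨆ i, upInc F i z

lemma Bdd.maxInc {F : (Fin n → 𝒳) → ℝ} (hF : Bdd F) : Bdd (maxInc F) := Bdd.iSup hF.upInc

variable (μ : Fin n → Measure 𝒳) [∀ i, IsProbabilityMeasure (μ i)]

lemma Bdd.upVar {F : (Fin n → 𝒳) → ℝ} (hF : Bdd F) : Bdd (upVar μ F) :=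
  Bdd.integral_right (f := fun z => ∑ i, MomentIneq.upInc F i z ^ 2) (Bdd.sum fun i => (hF.upInc i).sq)

lemma rpow_conj {q t : ℝ} (hq : 1 < q) (ht : 0 ≤ t) :
    (t ^ (q - 1)) ^ (q / (q - 1)) = t ^ q ∧ (t ^ (q - 1)) ^ (q / (q - 1) - 1) = t := by
  have hq1 : 0 < q - 1 := by linarith
  rw [← Real.rpow_mul ht, ← Real.rpow_mul ht, show (q - 1) * (q / (q - 1)) = q by field_simp,
    show (q - 1) * (q / (q - 1) - 1) = 1 by field_simp; ring, Real.rpow_one]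
  exact ⟨rfl, rfl⟩

lemma conj_mem {q : ℝ} (hq : 2 ≤ q) : 1 < q / (q - 1) ∧ q / (q - 1) ≤ 2 := by
  have hq1 : 0 < q - 1 := by linarith
  rw [one_lt_div hq1, div_le_iff₀ hq1]; constructor <;> linarith

/-- The exponent q/(q-1) is conjugate to q, which makes the entropy of the (q-1)-st power a
difference of two consecutive moments, both raised to the power q. -/
lemma rnorm_entropy {α : Type*} [MeasurableSpace α] {ν : Measure α} [IsProbabilityMeasure ν]
    {q : ℝ} (hq : 2 ≤ q) {f : α → ℝ} (hf : Bdd f) :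
    ∫ x, (f x ^ (q - 1)) ^ (q / (q - 1)) ∂ν - (∫ x, f x ^ (q - 1) ∂ν) ^ (q / (q - 1)) =
      rnorm ν q f ^ q - rnorm ν (q - 1) f ^ q := by
  have hq1 : 0 < q - 1 := by linarith
  simp only [(rpow_conj (by linarith : 1 < q) (hf.nonneg _)).1]
  rw [← rnorm_rpow (by linarith) hf, ← rnorm_rpow hq1 hf, ← Real.rpow_mul (rnorm_nonneg hf)]
  congr 2; field_simp

/-- The weight appearing in the entropy bound. -/
def wt (a b q s t : ℝ) : ℝ := a * s ^ (q - 2) + b * (s + t) ^ (q - 2)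

lemma wt_nonneg {a b q s t : ℝ} (ha : 0 ≤ a) (hb : 0 ≤ b) (hs : 0 ≤ s) (ht : 0 ≤ t) :
    0 ≤ wt a b q s t := by unfold wt; positivity

lemma Bdd.wt {α : Type*} [MeasurableSpace α] {f g : α → ℝ} {a b q : ℝ} (ha : 0 ≤ a) (hb : 0 ≤ b)
    (hq : 2 ≤ q) (hf : Bdd f) (hg : Bdd g) : Bdd fun x => wt a b q (f x) (g x) :=
  ((hf.rpow (by linarith : 0 ≤ q - 2)).const_mul ha).add
    (((hf.add hg).rpow (by linarith : 0 ≤ q - 2)).const_mul hb)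

lemma weight_nonneg {q a b : ℝ} (hab : a = 0 ∧ b = 1 ∨ 3 ≤ q ∧ a = 1 / 2 ∧ b = 1 / 2) :
    0 ≤ a ∧ 0 ≤ b := by
  rcases hab with ⟨rfl, rfl⟩ | ⟨-, rfl, rfl⟩ <;> norm_num

/-- A resampling that lowers F raises the lower deviation, by at most `upInc F i z`;
`rpow_sub_mul_sub_le` then bounds each term. -/
lemma entropy_lowerDev_le {q a b : ℝ} (hq : 2 ≤ q)
    (hab : a = 0 ∧ b = 1 ∨ 3 ≤ q ∧ a = 1 / 2 ∧ b = 1 / 2) {F : (Fin n → 𝒳) → ℝ} (hF : Bdd F)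
    (c : ℝ) :
    rnorm (Measure.pi μ) q (lowerDev F c) ^ q - rnorm (Measure.pi μ) (q - 1) (lowerDev F c) ^ q ≤
      q * ∫ z, ∑ i, upInc F i z ^ 2 * wt a b q (lowerDev F c z.1) (upInc F i z)
        ∂(Measure.pi μ).prod (Measure.pi μ) := by
  have hξ := hF.lowerDev c
  obtain ⟨ha, hb⟩ := weight_nonneg hab
  have hf := hξ.rpow (by linarith : 0 ≤ q - 1)
  rw [← rnorm_entropy hq hξ]
  have hY : ∀ i, Bdd fun z => upInc F i z ^ 2 * wt a b q (lowerDev F c z.1) (upInc F i z) :=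
    fun i => (hF.upInc i).sq.mul (Bdd.wt ha hb hq (hξ.comp measurable_fst) (hF.upInc i))
  refine (entropy_le_resample_symm μ (conj_mem hq).1 (conj_mem hq).2 hf.meas hF.meas hf.nonneg
    hf.bdd.choose_spec fun x y h => by rw [lowerDev_eq, lowerDev_eq, h]).trans ?_
  rw [integral_finsetSum _ fun i _ => (hY i).integrable, Finset.mul_sum]
  refine Finset.sum_le_sum fun i _ => ?_
  rw [← integral_const_mul]
  refine integral_mono_of_nonneg (ae_of_all _ fun z => ?_)
    ((hY i).const_mul (by linarith : 0 ≤ q)).integrable (ae_of_all _ fun z => ?_)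
  · simp only [Pi.zero_apply]
    split_ifs with h
    · rw [(rpow_conj (by linarith : 1 < q) (hξ.nonneg _)).2,
        (rpow_conj (by linarith : 1 < q) (hξ.nonneg _)).2]
      have h1 := lowerDev_anti c h.le
      have h2 := Real.rpow_le_rpow (hξ.nonneg _) h1 (by linarith : 0 ≤ q - 1)
      nlinarith
    · exact le_rfl
  · simp only
    split_ifs with h
    · rw [(rpow_conj (by linarith : 1 < q) (hξ.nonneg _)).2,
        (rpow_conj (by linarith : 1 < q) (hξ.nonneg _)).2]
      have := rpow_sub_mul_sub_le hq hab (hξ.nonneg z.1) (lowerDev_anti c h.le)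
        (lowerDev_resample_le F c i z)
      unfold wt
      linarith
    · exact mul_nonneg (by linarith) ((hY i).nonneg z)

/-- For fixed x the increment `upInc F i (x, x')` depends on x' only through its i-th coordinate, so
`decouple` applies to x' with h = `wt a b q (ξ x)`. The level is the one that Markov's inequality
gives conditionally on x. -/
lemma integral_decouple_le {q a b : ℝ} (hq : 2 ≤ q) (ha : 0 ≤ a) (hb : 0 ≤ b)
    {F ξ : (Fin n → 𝒳) → ℝ} (hF : Bdd F) (hξ : Bdd ξ) :
    ∫ z, ∑ i, upInc F i z ^ 2 * wt a b q (ξ z.1) (upInc F i z)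
        ∂(Measure.pi μ).prod (Measure.pi μ) ≤
      ∫ x, upVar μ F x * wt a b q (ξ x) ((5 * ∫ x', maxInc F (x, x') ^ q ∂Measure.pi μ) ^ (1 / q))
        ∂Measure.pi μ
      + 5 / 4 * ∫ z, maxInc F z ^ 2 * wt a b q (ξ z.1) (maxInc F z)
        ∂(Measure.pi μ).prod (Measure.pi μ) := by
  set ν := Measure.pi μ
  have hY : Bdd fun z => ∑ i, upInc F i z ^ 2 * wt a b q (ξ z.1) (upInc F i z) :=
    Bdd.sum fun i => (hF.upInc i).sq.mul (Bdd.wt ha hb hq (hξ.comp measurable_fst) (hF.upInc i))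
  have hM : Bdd fun z => maxInc F z ^ 2 * wt a b q (ξ z.1) (maxInc F z) :=
    hF.maxInc.sq.mul (Bdd.wt ha hb hq (hξ.comp measurable_fst) hF.maxInc)
  have hT : Bdd fun x => (5 * ∫ x', maxInc F (x, x') ^ q ∂ν) ^ (1 / q) :=
    ((Bdd.integral_right (hF.maxInc.rpow (by linarith : 0 ≤ q))).const_mul (by norm_num)).rpow
      (by positivity)
  have hV : Bdd fun x => upVar μ F x *
      wt a b q (ξ x) ((5 * ∫ x', maxInc F (x, x') ^ q ∂ν) ^ (1 / q)) :=
    (hF.upVar μ).mul (Bdd.wt ha hb hq hξ hT)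
  rw [integral_prod _ hY.integrable, integral_prod _ hM.integrable, ← integral_const_mul,
    ← integral_add hV.integrable (hM.integral_right.const_mul (by norm_num)).integrable]
  refine integral_mono hY.integral_right.integrable
    (hV.add (hM.integral_right.const_mul (by norm_num))).integrable fun x => ?_
  have hq2 : 0 ≤ q - 2 := by linarith
  have hupd : ∀ i, Measurable fun w : 𝒳 => Function.update x i w := fun i => measurable_update x
  have hd := decouple μ (y := fun i w => (F x - F (Function.update x i w))⁺)
    (fun i => (Bdd.const (hF.nonneg x)).of_le
      ((measurable_const.sub (hF.meas.comp (hupd i))).max measurable_const)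
      (fun _ => posPart_nonneg _)
      (fun w => max_le (by linarith [hF.nonneg (Function.update x i w)]) (hF.nonneg x)))
    (h := fun t => wt a b q (ξ x) t) (by unfold wt; fun_prop)
    (fun s hs t _ hst => by
      have h1 := hξ.nonneg x
      have h2 : 0 ≤ s := hs
      simp only [wt]; gcongr)
    (fun t ht => wt_nonneg ha hb (hξ.nonneg x) ht)
    (hF.maxInc.comp measurable_prodMk_left)
    (fun i x' => le_iSup_fin (f := fun i => upInc F i (x, x')) i)
    (hT.nonneg x)
    (by
      refine (prob_le_level (μ := ν) (hF.maxInc.comp (measurable_prodMk_left (x := x)))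
        (by linarith : 0 < q)).trans (measureReal_mono fun x' hx' i => ?_)
      exact (le_iSup_fin (f := fun i => upInc F i (x, x')) i).trans hx')
  refine hd.trans_eq ?_
  rw [mul_comm (upVar μ F x)]
  rfl

/-- Moment recursion for the lower deviation, in terms of resampling. -/
theorem rnorm_lowerDev_le {q a b : ℝ} (hq : 2 ≤ q)
    (hab : a = 0 ∧ b = 1 ∨ 3 ≤ q ∧ a = 1 / 2 ∧ b = 1 / 2) {F : (Fin n → 𝒳) → ℝ} (hF : Bdd F)
    (c : ℝ) {N v m : ℝ} (hN : N = rnorm (Measure.pi μ) q (lowerDev F c))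
    (hv : v = rnorm (Measure.pi μ) (q / 2) (upVar μ F))
    (hm : m = rnorm ((Measure.pi μ).prod (Measure.pi μ)) q (maxInc F)) :
    N ^ q ≤ rnorm (Measure.pi μ) (q - 1) (lowerDev F c) ^ q +
      q * (v * wt a b q N (5 ^ (1 / q) * m) + 5 / 4 * (m ^ 2 * wt a b q N m)) := by
  set ν := Measure.pi μ
  have hξ := hF.lowerDev c
  obtain ⟨ha, hb⟩ := weight_nonneg hab
  have hq0 : 0 < q := by linarith
  have hq2 : 0 ≤ q - 2 := by linarith
  have h1 := entropy_lowerDev_le μ hq hab hF c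
  have h2 := integral_decouple_le μ hq ha hb hF hξ
  set T : (Fin n → 𝒳) → ℝ := fun x => (5 * ∫ x', maxInc F (x, x') ^ q ∂ν) ^ (1 / q) with hT_def
  have hT : Bdd T := ((Bdd.integral_right (hF.maxInc.rpow hq0.le)).const_mul (by norm_num)).rpow
      (by positivity)
  -- T^q is 5 times a conditional expectation of the q-th power of the maximum, so its L^q norm is
  -- known exactly.
  have hTn : rnorm ν q T = 5 ^ (1 / q) * m := by
    have hI := (hF.maxInc.rpow hq0.le).integrable (μ := ν.prod ν)
    have e : ∀ x, T x ^ q = 5 * ∫ x', maxInc F (x, x') ^ q ∂ν := fun x => by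
      rw [hT_def]; simp only
      rw [← Real.rpow_mul (mul_nonneg (by norm_num)
        ((Bdd.integral_right (hF.maxInc.rpow hq0.le)).nonneg x)), one_div_mul_cancel hq0.ne',
        Real.rpow_one]
    rw [hm]
    unfold rnorm
    simp only [e]
    rw [integral_const_mul, integral_prod _ hI, Real.mul_rpow (by norm_num)
      (integral_nonneg fun x => (Bdd.integral_right (hF.maxInc.rpow hq0.le)).nonneg x)]
  -- Hölder's inequality followed by Minkowski's replaces the functions inside the weight by their
  -- L^q norms.
  have hwt : ∀ {α : Type _} [MeasurableSpace α] {P : Measure α} [IsProbabilityMeasure P]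
      {u f g : α → ℝ}, Bdd u → Bdd f → Bdd g → ∫ x, u x * wt a b q (f x) (g x) ∂P ≤
      rnorm P (q / 2) u * wt a b q (rnorm P q f) (rnorm P q g) := by
    intro α _ P _ u f g hu hf hg
    have i1 := (hu.mul (hf.rpow hq2)).integrable (μ := P)
    have i2 := (hu.mul ((hf.add hg).rpow hq2)).integrable (μ := P)
    have e : ∀ x, u x * wt a b q (f x) (g x) =
        a * (u x * f x ^ (q - 2)) + b * (u x * (f x + g x) ^ (q - 2)) := fun x => by
      unfold wt; ring
    simp only [e]
    rw [integral_add (i1.const_mul a) (i2.const_mul b), integral_const_mul, integral_const_mul]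
    have h3 := integral_mul_rpow_le (μ := P) hq hu hf
    have h4 := integral_mul_rpow_le (μ := P) hq hu (hf.add hg)
    have h5 := Real.rpow_le_rpow (rnorm_nonneg (hf.add hg))
      (rnorm_add_le (μ := P) (by linarith : 1 ≤ q) hf hg) hq2
    have h6 := h4.trans (mul_le_mul_of_nonneg_left h5 (rnorm_nonneg hu))
    have h7 := mul_le_mul_of_nonneg_left h3 ha
    have h8 := mul_le_mul_of_nonneg_left h6 hb
    unfold wt
    linarith
  have h3 := hwt (P := ν) (hF.upVar μ) hξ hT
  have h4 := hwt (P := ν.prod ν) hF.maxInc.sq (hξ.comp measurable_fst) hF.maxInc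
  rw [rnorm_sq hq0 hF.maxInc, rnorm_prod_fst q (lowerDev F c), ← hm] at h4
  rw [hTn] at h3
  rw [← hN] at h1 h3 h4
  rw [← hv] at h3
  have h5 := mul_le_mul_of_nonneg_left (h2.trans (add_le_add h3
    (mul_le_mul_of_nonneg_left h4 (by norm_num : (0 : ℝ) ≤ 5 / 4)))) hq0.le
  linarith


lemma rnorm_two_lowerDev_le {α : Type*} [MeasurableSpace α] {ν : Measure α}
    [IsProbabilityMeasure ν] {F : α → ℝ} (hF : Bdd F) :
    rnorm ν 2 (lowerDev F (∫ x, F x ∂ν)) ^ 2 ≤ ∫ x, F x ^ (2 : ℝ) ∂ν - (∫ x, F x ∂ν) ^ (2 : ℝ) := by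
  set c := ∫ x, F x ∂ν
  have hξ := hF.lowerDev c
  have h1 := rnorm_rpow (μ := ν) (q := 2) (by norm_num) hξ
  simp only [Real.rpow_two] at h1 ⊢
  rw [h1]
  have h2 : ∫ x, (1 * F x ^ 2 + (-(2 * c)) * F x - (-c ^ 2)) ∂ν = ∫ x, F x ^ 2 ∂ν - c ^ 2 := by
    rw [integral_affine hF.sq.integrable hF.integrable]; ring
  rw [← h2]
  refine integral_mono hξ.sq.integrable
    (((hF.sq.integrable.const_mul 1).add (hF.integrable.const_mul _)).sub
      (integrable_const _)) fun x => ?_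
  simp only
  have h3 : lowerDev F c x ^ 2 ≤ (F x - c) ^ 2 := by
    rw [lowerDev_eq]
    rcases le_total (c - F x) 0 with h | h
    · rw [max_eq_right h]; nlinarith [sq_nonneg (F x - c)]
    · rw [max_eq_left h]; nlinarith
  linarith

/-- Variance bound in terms of resampling. -/
theorem rnorm_two_lowerDev_le_upVar {F : (Fin n → 𝒳) → ℝ} (hF : Bdd F) :
    rnorm (Measure.pi μ) 2 (lowerDev F (∫ x, F x ∂Measure.pi μ)) ^ 2 ≤
      ∫ x, upVar μ F x ∂Measure.pi μ := by
  refine (rnorm_two_lowerDev_le hF).trans ?_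
  refine (entropy_le_resample_symm μ one_lt_two le_rfl hF.meas hF.meas hF.nonneg
    hF.bdd.choose_spec fun x y h => h).trans ?_
  have hY : ∀ i, Bdd fun z => upInc F i z ^ 2 := fun i => (hF.upInc i).sq
  unfold upVar
  rw [← integral_prod (fun z => ∑ i, upInc F i z ^ 2) (Bdd.sum hY).integrable,
    integral_finsetSum _ fun i _ => (hY i).integrable]
  refine Finset.sum_le_sum fun i _ => le_of_eq (integral_congr_ae (ae_of_all _ fun z => ?_))
  simp only [upInc, show (2 : ℝ) - 1 = 1 by norm_num, Real.rpow_one]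
  split_ifs with h
  · rw [posPart_eq_self.2 (by linarith)]; ring
  · rw [posPart_eq_zero.2 (by linarith)]; simp

/-! ### Leave-one-out references -/

/-- Moment recursion for the lower deviation, in terms of references `g i ≤ F` not depending on
the `i`-th coordinate. -/
theorem rnorm_lowerDev_le_of_ref {q : ℝ} (hq : 2 ≤ q) {F : (Fin n → 𝒳) → ℝ}
    {g : Fin n → (Fin n → 𝒳) → ℝ} (hF : Bdd F) (hg : ∀ i, Bdd (g i))
    (hind : ∀ i x y, g i (Function.update x i y) = g i x)
    (hgF : ∀ i, ∀ᵐ x ∂Measure.pi μ, g i x ≤ F x) (c : ℝ) {N v m : ℝ}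
    (hN : N = rnorm (Measure.pi μ) q (lowerDev F c))
    (hv : v = rnorm (Measure.pi μ) (q / 2) fun x => ∑ i, |F x - g i x| ^ 2)
    (hm : m = rnorm (Measure.pi μ) q fun x => ⨆ i, |F x - g i x|) :
    N ^ q ≤ rnorm (Measure.pi μ) (q - 1) (lowerDev F c) ^ q + q / 2 * (v * (N + m) ^ (q - 2)) := by
  set ν := Measure.pi μ
  have hξ := hF.lowerDev c
  have hq2 : 0 ≤ q - 2 := by linarith
  have hq1 : 0 ≤ q - 1 := by linarith
  -- As g i ≤ F holds only almost everywhere, absolute values keep these functions nonnegative at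
  -- every point.
  have hd : ∀ i, Bdd fun x => |F x - g i x| := fun i => by
    refine (hF.add (hg i)).of_le (hF.meas.sub (hg i).meas).abs (fun x => abs_nonneg _) fun x => ?_
    rw [abs_le]; constructor <;> linarith [hF.nonneg x, (hg i).nonneg x]
  have hM : Bdd fun x => ⨆ i, |F x - g i x| := Bdd.iSup hd
  have hV : Bdd fun x => ∑ i, |F x - g i x| ^ 2 := Bdd.sum fun i => (hd i).sq
  have hf := hξ.rpow hq1
  have hgr : ∀ i, Bdd fun x => lowerDev (g i) c x ^ (q - 1) := fun i => ((hg i).lowerDev c).rpow hq1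
  obtain ⟨B, hB0, hB⟩ := hf.exists_bound
  choose C hC0 hC using fun i => (hgr i).exists_bound
  have h1 := entropy_pi_le (conj_mem hq).1 (conj_mem hq).2 μ hf.meas (fun i => (hgr i).meas)
    (B := B + ∑ i, C i) hf.nonneg
    (fun x => by linarith [hB x, Finset.sum_nonneg fun i (_ : i ∈ Finset.univ) => hC0 i])
    (fun i => (hgr i).nonneg) (fun i x => by
      have := Finset.single_le_sum (fun i _ => hC0 i) (Finset.mem_univ i)
      linarith [hC i x])
    (fun i x y => by rw [lowerDev_eq, lowerDev_eq, hind])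
  rw [rnorm_entropy hq hξ, ← hN] at h1
  have hW : Bdd fun x => (lowerDev F c x + ⨆ i, |F x - g i x|) ^ (q - 2) := (hξ.add hM).rpow hq2
  have hterm : ∀ i, Bdd fun x => |F x - g i x| ^ 2 *
      (lowerDev F c x + ⨆ i, |F x - g i x|) ^ (q - 2) := fun i => (hd i).sq.mul hW
  have h2 : ∀ i, ∫ x, breg (q / (q - 1)) (lowerDev F c x ^ (q - 1)) (lowerDev (g i) c x ^ (q - 1)) ∂ν
      ≤ q / 2 * ∫ x, |F x - g i x| ^ 2 * (lowerDev F c x + ⨆ i, |F x - g i x|) ^ (q - 2) ∂ν :=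
    fun i => by
    rw [← integral_const_mul]
    refine integral_mono_of_nonneg (ae_of_all _ fun x => breg_nonneg (conj_mem hq).1
      (hf.nonneg x) ((hgr i).nonneg x)) ((hterm i).const_mul (by linarith : 0 ≤ q / 2)).integrable ?_
    filter_upwards [hgF i] with x hx
    have h3 : lowerDev F c x ≤ lowerDev (g i) c x := by
      rw [lowerDev_eq, lowerDev_eq]; exact max_le_max (by linarith) le_rfl
    have h4 : lowerDev (g i) c x ≤ lowerDev F c x + |F x - g i x| := by
      rw [lowerDev_eq, lowerDev_eq, abs_of_nonneg (by linarith)]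
      have h5 := le_max_left (c - F x) 0
      have h6 := le_max_right (c - F x) 0
      exact max_le (by linarith) (by linarith)
    have h5 : |F x - g i x| ≤ ⨆ i, |F x - g i x| := le_iSup_fin (f := fun i => |F x - g i x|) i
    have h6 := hξ.nonneg x
    have h7 := ((hg i).lowerDev c).nonneg x
    refine (breg_rpow_le hq h6 h3).trans ?_
    have h8 : (lowerDev (g i) c x - lowerDev F c x) ^ 2 ≤ |F x - g i x| ^ 2 := by
      have : lowerDev (g i) c x - lowerDev F c x ≤ |F x - g i x| := by linarith
      have : 0 ≤ lowerDev (g i) c x - lowerDev F c x := by linarith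
      gcongr
    have h9 : lowerDev (g i) c x ^ (q - 2) ≤ (lowerDev F c x + ⨆ i, |F x - g i x|) ^ (q - 2) :=
      Real.rpow_le_rpow h7 (by linarith) hq2
    rw [mul_assoc]
    gcongr
  have h3 := h1.trans (Finset.sum_le_sum fun i _ => h2 i)
  rw [← Finset.mul_sum, ← integral_finsetSum _ fun i _ => (hterm i).integrable] at h3
  simp only [← Finset.sum_mul] at h3
  have h4 := integral_mul_rpow_le (μ := ν) hq hV (hξ.add hM)
  have h5 := Real.rpow_le_rpow (rnorm_nonneg (hξ.add hM))
    (rnorm_add_le (μ := ν) (by linarith : 1 ≤ q) hξ hM) hq2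
  have h6 := h4.trans (mul_le_mul_of_nonneg_left h5 (rnorm_nonneg hV))
  rw [← hN, ← hv, ← hm] at h6
  have h7 := mul_le_mul_of_nonneg_left h6 (by linarith : 0 ≤ q / 2)
  linarith

/-- Variance bound in terms of leave-one-out references. -/
theorem rnorm_two_lowerDev_le_ref {F : (Fin n → 𝒳) → ℝ}
    {g : Fin n → (Fin n → 𝒳) → ℝ} (hF : Bdd F) (hg : ∀ i, Bdd (g i))
    (hind : ∀ i x y, g i (Function.update x i y) = g i x) :
    rnorm (Measure.pi μ) 2 (lowerDev F (∫ x, F x ∂Measure.pi μ)) ^ 2 ≤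
      ∫ x, ∑ i, |F x - g i x| ^ 2 ∂Measure.pi μ := by
  have hd : ∀ i, Bdd fun x => |F x - g i x| := fun i => by
    refine (hF.add (hg i)).of_le (hF.meas.sub (hg i).meas).abs (fun x => abs_nonneg _) fun x => ?_
    rw [abs_le]; constructor <;> linarith [hF.nonneg x, (hg i).nonneg x]
  refine (rnorm_two_lowerDev_le hF).trans ?_
  obtain ⟨B, hB0, hB⟩ := hF.exists_bound
  choose C hC0 hC using fun i => (hg i).exists_bound
  refine (entropy_pi_le one_lt_two le_rfl μ hF.meas (fun i => (hg i).meas)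
    (B := B + ∑ i, C i) hF.nonneg
    (fun x => by linarith [hB x, Finset.sum_nonneg fun i (_ : i ∈ Finset.univ) => hC0 i])
    (fun i => (hg i).nonneg) (fun i x => by
      have := Finset.single_le_sum (fun i _ => hC0 i) (Finset.mem_univ i)
      linarith [hC i x]) hind).trans_eq ?_
  rw [integral_finsetSum _ fun i _ => ((hd i).sq).integrable]
  refine Finset.sum_congr rfl fun i _ => integral_congr_ae (ae_of_all _ fun x => ?_)
  -- For p = 2 the divergence is the square (u - v)².
  simp only [breg, sq_abs, Real.rpow_two, show (2 : ℝ) - 1 = 1 by norm_num, Real.rpow_one]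
  ring

end Recursion

/-! ### Numerical estimates and solution of the recursion -/

lemma exp_le_of_pow {t c : ℝ} {k : ℕ} (hk : k ≠ 0) (hc : 0 ≤ c) (ht : k * t = 1)
    (h : 2.7182818286 ≤ c ^ k) : Real.exp t ≤ c := by
  refine le_of_pow_le_pow_left₀ hk hc ?_
  rw [← Real.exp_nat_mul, ht]
  exact Real.exp_one_lt_d9.le.trans h

lemma exp_neg_half_le : Real.exp (-(1 / 2)) ≤ 0.60654 := by
  rw [Real.exp_neg, inv_le_comm₀ (Real.exp_pos _) (by norm_num)]
  refine le_of_pow_le_pow_left₀ two_ne_zero (Real.exp_pos _).le ?_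
  rw [← Real.exp_nat_mul]
  norm_num
  exact le_trans (by norm_num) Real.exp_one_gt_d9.le

lemma contraction_le_exp {q : ℝ} (hq : 2 ≤ q) : (1 - 1 / q) ^ (q / 2) ≤ 0.60654 := by
  have h1 : 0 ≤ 1 - 1 / q := by
    rw [sub_nonneg, div_le_one (by linarith)]; linarith
  refine le_trans ?_ exp_neg_half_le
  have h2 : 1 - 1 / q ≤ Real.exp (-(1 / q)) := by
    linarith [Real.add_one_le_exp (-(1 / q))]
  refine (Real.rpow_le_rpow h1 h2 (by linarith)).trans_eq ?_
  rw [← Real.exp_mul]; congr 1; field_simp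

/-- (1 - 1/q)^q increases with q: Bernoulli's inequality with exponent q/Q ≤ 1 compares it with its
value at Q. On bounded ranges of q this improves on the limit e^(-1/2) of (1 - 1/q)^(q/2). -/
lemma contraction_le {q Q c : ℝ} (hq : 2 ≤ q) (hqQ : q ≤ Q) (hc : 0 ≤ c)
    (h : (1 - 1 / Q) ^ Q ≤ c ^ 2) : (1 - 1 / q) ^ (q / 2) ≤ c := by
  have hq0 : 0 < q := by linarith
  have hQ0 : 0 < Q := by linarith
  have h1 : 0 ≤ 1 - 1 / q := by
    rw [sub_nonneg, div_le_one (by linarith)]; linarith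
  have h2 : (1 - 1 / q) ^ (q / Q) ≤ 1 - 1 / Q := by
    have := rpow_one_add_le_one_add_mul_self (s := -(1 / q)) (p := q / Q) (by linarith)
      (by positivity) ((div_le_one hQ0).2 hqQ)
    refine (le_of_eq ?_).trans (this.trans_eq ?_)
    · ring_nf
    · field_simp; ring
  refine le_of_pow_le_pow_left₀ two_ne_zero hc ?_
  rw [← Real.rpow_natCast, ← Real.rpow_mul h1]
  refine le_trans ?_ h
  calc (1 - 1 / q) ^ (q / 2 * (2 : ℕ)) = ((1 - 1 / q) ^ (q / Q)) ^ Q := by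
        rw [← Real.rpow_mul h1]; congr 1; push_cast; field_simp
    _ ≤ _ := Real.rpow_le_rpow (Real.rpow_nonneg h1 _) h2 hQ0.le

lemma one_add_rpow_le_exp {q t c : ℝ} (hq : 2 ≤ q) (ht : 0 ≤ t) (h : t * (q - 2) ≤ c) :
    (1 + t) ^ (q - 2) ≤ Real.exp c := by
  refine (Real.rpow_le_rpow (by linarith) (by linarith [Real.add_one_le_exp t] :
    1 + t ≤ Real.exp t) (by linarith)).trans ?_
  rw [← Real.exp_mul]
  exact Real.exp_le_exp.2 h

lemma exp_ratio_le : Real.exp (200 / 311) ≤ 1.9025 := by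
  refine (Real.exp_bound' (by norm_num) (by norm_num) (n := 8) (by norm_num)).trans ?_
  norm_num [Finset.sum_range_succ, Nat.factorial]

/-- 200/311 = 1/1.555 and 1.555² ≤ 2.4195, so this is the bound on q m / N available when N² exceeds
2.4195 q² m². The two estimates add up to about 0.9997. -/
lemma contraction_ref {q : ℝ} (hq : 2 ≤ q) :
    (1 - 1 / q) ^ (q / 2) + 1 / (2 * 2.4195) * (1 + 200 / (311 * q)) ^ (q - 2) < 1 := by
  have h1 := contraction_le_exp hq
  have h2 : (1 + 200 / (311 * q)) ^ (q - 2) ≤ Real.exp (200 / 311) :=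
    one_add_rpow_le_exp hq (by positivity) (by
      rw [div_mul_eq_mul_div, div_le_div_iff₀ (by positivity) (by norm_num)]; nlinarith)
  have h3 := h2.trans exp_ratio_le
  norm_num at h1 h3 ⊢
  linarith

/-- As 5 ≤ e², the factor 5^(1/q) ≤ e^(2/q) is absorbed by 1 - 2/q ≤ e^(-2/q). Hence the level for
probability 4/5 still gives a weight at most e^(1/2) in `contraction_copy`. -/
lemma five_rpow_mul_le {q : ℝ} (hq : 2 ≤ q) : (5 : ℝ) ^ (1 / q) * (1 - 2 / q) ≤ 1 := by
  have h5 : (5 : ℝ) ≤ Real.exp 2 := by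
    have h1 : Real.exp 2 = Real.exp 1 ^ 2 := by rw [← Real.exp_nat_mul]; norm_num
    rw [h1]; nlinarith [Real.exp_one_gt_d9]
  have h1 : (5 : ℝ) ^ (1 / q) ≤ Real.exp (2 / q) := by
    refine (Real.rpow_le_rpow (by norm_num) h5 (by positivity)).trans_eq ?_
    rw [← Real.exp_mul]; congr 1; ring
  have h2 : 1 - 2 / q ≤ Real.exp (-(2 / q)) := by linarith [Real.add_one_le_exp (-(2 / q))]
  have h3 : 0 ≤ 1 - 2 / q := by
    rw [sub_nonneg, div_le_one (by linarith)]; exact hq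
  calc (5 : ℝ) ^ (1 / q) * (1 - 2 / q) ≤ Real.exp (2 / q) * Real.exp (-(2 / q)) := by gcongr
    _ = 1 := by rw [← Real.exp_add]; simp

/-- The ratio 1/(2q) bounds m / N because 4.159 ≥ 4. The range of q is cut at 3, 4 and 6, since (1 -
1/q)^(q/2) grows with q while the factor 5/(4q) of the decoupling error shrinks. -/
lemma contraction_copy {q : ℝ} (hq : 2 ≤ q) :
    ∃ a b : ℝ, (a = 0 ∧ b = 1 ∨ 3 ≤ q ∧ a = 1 / 2 ∧ b = 1 / 2) ∧
      (1 - 1 / q) ^ (q / 2) + 1 / 4.159 * (wt a b q 1 (5 ^ (1 / q) * (1 / (2 * q))) +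
        5 / 4 / q * wt a b q 1 (1 / (2 * q))) < 1 := by
  have hq0 : 0 < q := by linarith
  have h50 : 0 ≤ (5 : ℝ) ^ (1 / q) * (1 / (2 * q)) := by positivity
  have hE' : (1 + 5 ^ (1 / q) * (1 / (2 * q))) ^ (q - 2) ≤ 1.6488 := by
    refine (one_add_rpow_le_exp hq h50 (c := 1 / 2) ?_).trans
      (exp_le_of_pow (k := 2) (by norm_num) (by norm_num) (by norm_num) (by norm_num))
    have := five_rpow_mul_le hq
    calc (5 : ℝ) ^ (1 / q) * (1 / (2 * q)) * (q - 2) = 1 / 2 * (5 ^ (1 / q) * (1 - 2 / q)) := by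
          field_simp
      _ ≤ _ := by linarith
  have hE : ∀ Q : ℝ, q ≤ Q → (1 + 1 / (2 * q)) ^ (q - 2) ≤ Real.exp ((1 - 2 / Q) / 2) := fun Q hQ => by
    refine one_add_rpow_le_exp hq (by positivity) ?_
    have : 2 / Q ≤ 2 / q := by gcongr
    calc 1 / (2 * q) * (q - 2) = (1 - 2 / q) / 2 := by field_simp
      _ ≤ _ := by linarith
  rcases le_total q 3 with h3 | h3
  · refine ⟨0, 1, Or.inl ⟨rfl, rfl⟩, ?_⟩
    have hA : (1 - 1 / q) ^ (q / 2) ≤ 0.54434 := contraction_le hq h3 (by norm_num) (by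
      rw [show (3 : ℝ) = (3 : ℕ) by norm_num, Real.rpow_natCast]; norm_num)
    -- For q ≤ 3 the exponent q - 2 is at most 1, so Bernoulli bounds the powers by affine functions
    -- of w. A polynomial inequality on 0 ≤ w ≤ 1/3 remains; 1.11805 is about √5/2.
    set w := (q - 2) / q with hw
    have hw0 : 0 ≤ w := div_nonneg (by linarith) hq0.le
    have hw1 : w ≤ 1 / 3 := by rw [hw, div_le_div_iff₀ hq0 (by norm_num)]; linarith
    have hqw : 1 / q = (1 - w) / 2 := by rw [hw]; field_simp; ring
    have h5 : (5 : ℝ) ^ (1 / q) ≤ 2.2361 := by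
      have h1 : (5 : ℝ) ^ (1 / q) ≤ 5 ^ (1 / 2 : ℝ) :=
        Real.rpow_le_rpow_of_exponent_le (by norm_num) (by gcongr)
      refine h1.trans ?_
      rw [← Real.sqrt_eq_rpow, Real.sqrt_le_left (by norm_num)]; norm_num
    have e1 : (1 + 5 ^ (1 / q) * (1 / (2 * q))) ^ (q - 2) ≤ 1 + 1.11805 * w := by
      refine (rpow_one_add_le_one_add_mul_self (by linarith) (by linarith) (by linarith)).trans ?_
      have : (q - 2) * (5 ^ (1 / q) * (1 / (2 * q))) = 5 ^ (1 / q) / 2 * w := by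
        rw [hw]; field_simp
      rw [this]; norm_num at h5 ⊢; nlinarith
    have e2 : (1 + 1 / (2 * q)) ^ (q - 2) ≤ 1 + w / 2 := by
      refine (rpow_one_add_le_one_add_mul_self (by linarith [show 0 ≤ 1 / (2 * q) by positivity])
        (by linarith) (by linarith)).trans_eq ?_
      rw [hw]; field_simp
    have e3 : 5 / 4 / q * (1 + 1 / (2 * q)) ^ (q - 2) ≤ 5 / 8 * (1 - w) * (1 + w / 2) := by
      rw [show 5 / 4 / q = 5 / 8 * (1 - w) by rw [hw]; field_simp; ring]
      exact mul_le_mul_of_nonneg_left e2 (by linarith)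
    unfold wt
    norm_num at hA e1 e3 ⊢
    nlinarith [sq_nonneg w]
  · refine ⟨1 / 2, 1 / 2, Or.inr ⟨h3, rfl, rfl⟩, ?_⟩
    -- A bounds the contraction factor, E the power in the error term, and r is the left end of the
    -- range of q. The number 1.3244 is (1 + 1.6488)/2, with 1.6488 an upper bound for e^(1/2).
    have fin : ∀ A E r : ℝ, (1 - 1 / q) ^ (q / 2) ≤ A → r ≤ q → 0 < r → 0 ≤ E →
        (1 + 1 / (2 * q)) ^ (q - 2) ≤ E →
        A + 1 / 4.159 * (1.3244 + 5 / 4 / r * (1 / 2 + 1 / 2 * E)) < 1 →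
        (1 - 1 / q) ^ (q / 2) + 1 / 4.159 * (wt (1 / 2) (1 / 2) q 1 (5 ^ (1 / q) * (1 / (2 * q))) +
        5 / 4 / q * wt (1 / 2) (1 / 2) q 1 (1 / (2 * q))) < 1 := by
      intro A E r hA hr hr0 hE0 hE1 hlt
      refine lt_of_le_of_lt ?_ hlt
      unfold wt
      rw [Real.one_rpow, mul_one]
      have e1 : 1 / 2 + 1 / 2 * (1 + 5 ^ (1 / q) * (1 / (2 * q))) ^ (q - 2) ≤ 1.3244 := by
        norm_num at hE' ⊢; linarith
      gcongr
    rcases le_total q 4 with h4 | h4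
    · refine fin 0.5625 1.2841 3 (contraction_le hq h4 (by norm_num) (by
        rw [show (4 : ℝ) = (4 : ℕ) by norm_num, Real.rpow_natCast]; norm_num)) h3 (by norm_num)
        (by norm_num) ((hE 4 h4).trans (exp_le_of_pow (k := 4) (by norm_num) (by norm_num)
        (by norm_num) (by norm_num))) (by norm_num)
    · rcases le_total q 6 with h6 | h6
      · refine fin 0.57871 1.3957 4 (contraction_le hq h6 (by norm_num) (by
          rw [show (6 : ℝ) = (6 : ℕ) by norm_num, Real.rpow_natCast]; norm_num)) h4 (by norm_num)
          (by norm_num) ((hE 6 h6).trans (exp_le_of_pow (k := 3) (by norm_num) (by norm_num)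
          (by norm_num) (by norm_num))) (by norm_num)
      · refine fin 0.60654 1.6488 6 (contraction_le_exp hq) h6 (by norm_num) (by norm_num)
          ((one_add_rpow_le_exp hq (by positivity) (c := 1 / 2) ?_).trans
          (exp_le_of_pow (k := 2) (by norm_num) (by norm_num) (by norm_num) (by norm_num)))
          (by norm_num)
        rw [div_mul_eq_mul_div, div_le_div_iff₀ (by positivity) (by norm_num)]; linarith

/-- Solution of the moment recursion. -/
theorem sq_le_of_recursion {C : ℝ} (hC : 1 ≤ C) {N R : ℝ → ℝ} (hN0 : ∀ q, 0 ≤ N q)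
    (hNmono : ∀ p q, 0 < p → p ≤ q → N p ≤ N q) (hR0 : ∀ q, 0 ≤ R q)
    (hRmono : ∀ p q, 2 ≤ p → p ≤ q → R p ≤ R q) (hbase : N 2 ^ 2 ≤ R 2)
    (hstep : ∀ q, 2 ≤ q → C * q * R q < N q ^ 2 → ∃ b, (1 - 1 / q) ^ (q / 2) + b < 1 ∧
      N q ^ q ≤ N (q - 1) ^ q + b * N q ^ q) {q : ℝ} (hq : 2 ≤ q) : N q ^ 2 ≤ C * q * R q := by
  -- Assuming the opposite inequality at q, the bound at q - 1 becomes N(q-1)² ≤ (1 - 1/q) N(q)²,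
  -- and the recursion contradicts N(q) > 0.
  have key : ∀ q, 2 ≤ q → N (q - 1) ^ 2 ≤ C * (q - 1) * R q → N q ^ 2 ≤ C * q * R q := by
    intro q hq h
    by_contra hlt
    push Not at hlt
    obtain ⟨b, hb, hrec⟩ := hstep q hq hlt
    have hq0 : 0 < q := by linarith
    have h1 : 0 ≤ 1 - 1 / q := by
      rw [sub_nonneg, div_le_one hq0]; linarith
    have hNq : 0 < N q := by
      refine lt_of_le_of_ne (hN0 q) fun h0 => ?_
      rw [← h0] at hlt
      have : 0 ≤ C * q * R q := mul_nonneg (mul_nonneg (by linarith) hq0.le) (hR0 q)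
      norm_num at hlt
      linarith
    have h2 : N (q - 1) ^ 2 ≤ (1 - 1 / q) * N q ^ 2 := by
      refine h.trans ?_
      calc C * (q - 1) * R q = (1 - 1 / q) * (C * q * R q) := by field_simp
        _ ≤ _ := by gcongr
    have hp : ∀ t : ℝ, 0 ≤ t → (t ^ 2) ^ (q / 2) = t ^ q := fun t ht => by
      rw [← Real.rpow_natCast, ← Real.rpow_mul ht]; congr 1; push_cast; ring
    have h3 := Real.rpow_le_rpow (sq_nonneg _) h2 (by linarith : 0 ≤ q / 2)
    rw [hp _ (hN0 _), Real.mul_rpow h1 (sq_nonneg _), hp _ (hN0 _)] at h3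
    have h4 : 0 < N q ^ q := Real.rpow_pos_of_pos hNq q
    nlinarith
  have main : ∀ k : ℕ, ∀ q : ℝ, 2 ≤ q → q ≤ 3 + k → N q ^ 2 ≤ C * q * R q := by
    -- Here q - 1 may lie below 2, outside the range of the recursion. Monotonicity of the norms and
    -- the variance bound at 2 suffice, because C (q - 1) ≥ 1.
    have small : ∀ q, 2 ≤ q → q ≤ 3 → N q ^ 2 ≤ C * q * R q := by
      intro q hq hq3
      refine key q hq ?_
      have h1 : N (q - 1) ^ 2 ≤ N 2 ^ 2 :=
        pow_le_pow_left₀ (hN0 _) (hNmono _ _ (by linarith) (by linarith)) 2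
      have h2 : 1 ≤ C * (q - 1) := by nlinarith
      have h3 := mul_le_mul_of_nonneg_right h2 (hR0 q)
      linarith [hRmono 2 q le_rfl hq]
    intro k
    induction k with
    | zero => exact fun q hq hq3 => small q hq (by simpa using hq3)
    | succ k ih =>
      intro q hq hqk
      rcases le_total q 3 with h3 | h3
      · exact small q hq h3
      · push_cast at hqk
        refine key q hq ((ih (q - 1) (by linarith) (by linarith)).trans ?_)
        have := hRmono (q - 1) q (by linarith) (by linarith)
        exact mul_le_mul_of_nonneg_left this (mul_nonneg (by linarith) (by linarith))
  obtain ⟨k, hk⟩ := exists_nat_ge q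
  exact main k q hq (by linarith)

/-! ### Moment bounds for bounded functions on a product space. -/

section Bounded

variable {𝒳 : Type*} [MeasurableSpace 𝒳] {n : ℕ} (μ : Fin n → Measure 𝒳)
  [∀ i, IsProbabilityMeasure (μ i)]

lemma rnorm_one {α : Type*} [MeasurableSpace α] {ν : Measure α} {f : α → ℝ} :
    rnorm ν (2 / 2) f = ∫ x, f x ∂ν := by
  simp [rnorm]

lemma wt_mul {a b q N t : ℝ} (hN : 0 ≤ N) (ht : 0 ≤ t) :
    wt a b q N (N * t) = N ^ (q - 2) * wt a b q 1 t := by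
  unfold wt
  rw [show N + N * t = N * (1 + t) by ring, Real.mul_rpow hN (by linarith), Real.one_rpow]
  ring

lemma wt_mono {a b q s t t' : ℝ} (hb : 0 ≤ b) (hq : 2 ≤ q) (hs : 0 ≤ s) (ht : 0 ≤ t) (h : t ≤ t') :
    wt a b q s t ≤ wt a b q s t' := by
  have : 0 ≤ q - 2 := by linarith
  unfold wt; gcongr

/-- Lower tail moments of a bounded function in terms of resampling. -/
theorem rnorm_lowerDev_sq_le {F : (Fin n → 𝒳) → ℝ} (hF : Bdd F) {q : ℝ} (hq : 2 ≤ q) :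
    rnorm (Measure.pi μ) q (lowerDev F (∫ x, F x ∂Measure.pi μ)) ^ 2 ≤
      4.159 * q * max (rnorm (Measure.pi μ) (q / 2) (upVar μ F))
        (q * rnorm ((Measure.pi μ).prod (Measure.pi μ)) q (maxInc F) ^ 2) := by
  set c := ∫ x, F x ∂Measure.pi μ
  have hξ := hF.lowerDev c
  refine sq_le_of_recursion (C := 4.159)
    (N := fun q => rnorm (Measure.pi μ) q (lowerDev F c))
    (R := fun q => max (rnorm (Measure.pi μ) (q / 2) (upVar μ F))
        (q * rnorm ((Measure.pi μ).prod (Measure.pi μ)) q (maxInc F) ^ 2))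
    (by norm_num) (fun q => rnorm_nonneg hξ) (fun p q hp hpq => rnorm_mono_exponent hp hpq hξ)
    (fun q => (rnorm_nonneg (hF.upVar μ)).trans (le_max_left _ _))
    (fun p q hp hpq => max_le_max (rnorm_mono_exponent (by linarith) (by linarith) (hF.upVar μ)) ?_)
    ?_ (fun q hq hlt => ?_) hq
  · have h1 := rnorm_mono_exponent (μ := (Measure.pi μ).prod (Measure.pi μ)) (by linarith) hpq
      hF.maxInc
    have h2 := rnorm_nonneg (μ := (Measure.pi μ).prod (Measure.pi μ)) (q := p) hF.maxInc
    have h3 : 0 ≤ q := by linarith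
    gcongr
  · refine (rnorm_two_lowerDev_le_upVar μ hF).trans ?_
    rw [rnorm_one]; exact le_max_left _ _
  · set N := rnorm (Measure.pi μ) q (lowerDev F c) with hN
    set v := rnorm (Measure.pi μ) (q / 2) (upVar μ F) with hv
    set m := rnorm ((Measure.pi μ).prod (Measure.pi μ)) q (maxInc F) with hm
    obtain ⟨a, b, hab, hlt1⟩ := contraction_copy hq
    obtain ⟨ha, hb⟩ := weight_nonneg hab
    refine ⟨_, hlt1, (rnorm_lowerDev_le μ hq hab hF c hN hv hm).trans ?_⟩
    have hq0 : 0 < q := by linarith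
    have hN0 : 0 ≤ N := rnorm_nonneg hξ
    have hm0 : 0 ≤ m := rnorm_nonneg hF.maxInc
    have hv1 : 4.159 * q * v ≤ N ^ 2 :=
      (mul_le_mul_of_nonneg_left (le_max_left _ _) (by positivity)).trans hlt.le
    have hm1 : 4.159 * q * (q * m ^ 2) ≤ N ^ 2 :=
      (mul_le_mul_of_nonneg_left (le_max_right _ _) (by positivity)).trans hlt.le
    have hm2 : m ≤ N * (1 / (2 * q)) := by
      refine le_of_pow_le_pow_left₀ two_ne_zero (by positivity) ?_
      rw [mul_pow, div_pow, one_pow, mul_one_div, le_div_iff₀ (by positivity)]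
      nlinarith [sq_nonneg (q * m)]
    have hNq : N ^ q = N ^ 2 * N ^ (q - 2) := by
      rcases eq_or_lt_of_le hN0 with h | h
      · rw [← h, Real.zero_rpow (by linarith)]; simp
      · rw [← Real.rpow_natCast, ← Real.rpow_add h]; norm_num
    have h5 : 0 ≤ (5 : ℝ) ^ (1 / q) := by positivity
    have w1 : wt a b q N (5 ^ (1 / q) * m) ≤
        N ^ (q - 2) * wt a b q 1 (5 ^ (1 / q) * (1 / (2 * q))) := by
      rw [← wt_mul hN0 (by positivity)]
      exact wt_mono hb hq hN0 (by positivity) (by nlinarith)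
    have w2 : wt a b q N m ≤ N ^ (q - 2) * wt a b q 1 (1 / (2 * q)) := by
      rw [← wt_mul hN0 (by positivity)]
      exact wt_mono hb hq hN0 hm0 hm2
    have hp : 0 ≤ N ^ (q - 2) := Real.rpow_nonneg hN0 _
    have u1 : 0 ≤ wt a b q 1 (5 ^ (1 / q) * (1 / (2 * q))) :=
      wt_nonneg ha hb zero_le_one (by positivity)
    have u2 : 0 ≤ wt a b q 1 (1 / (2 * q)) := wt_nonneg ha hb zero_le_one (by positivity)
    have s1 : q * v * wt a b q N (5 ^ (1 / q) * m) ≤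
        (N ^ 2 / 4.159) * (N ^ (q - 2) * wt a b q 1 (5 ^ (1 / q) * (1 / (2 * q)))) := by
      refine mul_le_mul ?_ w1 (wt_nonneg ha hb hN0 (by positivity)) (by positivity)
      rw [le_div_iff₀ (by norm_num)]; linarith
    have s2 : q * (5 / 4 * m ^ 2) * wt a b q N m ≤
        (5 / 4 * (N ^ 2 / (4.159 * q))) * (N ^ (q - 2) * wt a b q 1 (1 / (2 * q))) := by
      refine mul_le_mul ?_ w2 (wt_nonneg ha hb hN0 hm0) (by positivity)
      rw [mul_left_comm]
      refine mul_le_mul_of_nonneg_left ?_ (by norm_num)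
      rw [le_div_iff₀ (by positivity)]; linarith
    have e : 1 / 4.159 * (wt a b q 1 (5 ^ (1 / q) * (1 / (2 * q))) +
        5 / 4 / q * wt a b q 1 (1 / (2 * q))) * N ^ q =
        (N ^ 2 / 4.159) * (N ^ (q - 2) * wt a b q 1 (5 ^ (1 / q) * (1 / (2 * q)))) +
        (5 / 4 * (N ^ 2 / (4.159 * q))) * (N ^ (q - 2) * wt a b q 1 (1 / (2 * q))) := by
      rw [hNq]; field_simp
    rw [e]
    linarith

/-- Lower tail moments of a bounded function in terms of leave-one-out references. -/
theorem rnorm_lowerDev_sq_le_of_ref {F : (Fin n → 𝒳) → ℝ} {g : Fin n → (Fin n → 𝒳) → ℝ}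
    (hF : Bdd F) (hg : ∀ i, Bdd (g i)) (hind : ∀ i x y, g i (Function.update x i y) = g i x)
    (hgF : ∀ i, ∀ᵐ x ∂Measure.pi μ, g i x ≤ F x) {q : ℝ} (hq : 2 ≤ q) :
    rnorm (Measure.pi μ) q (lowerDev F (∫ x, F x ∂Measure.pi μ)) ^ 2 ≤
      2.4195 * q * max (rnorm (Measure.pi μ) (q / 2) fun x => ∑ i, |F x - g i x| ^ 2)
        (q * rnorm (Measure.pi μ) q (fun x => ⨆ i, |F x - g i x|) ^ 2) := by
  set c := ∫ x, F x ∂Measure.pi μ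
  have hξ := hF.lowerDev c
  have hd : ∀ i, Bdd fun x => |F x - g i x| := fun i => by
    refine (hF.add (hg i)).of_le (hF.meas.sub (hg i).meas).abs (fun x => abs_nonneg _) fun x => ?_
    rw [abs_le]; constructor <;> linarith [hF.nonneg x, (hg i).nonneg x]
  have hM : Bdd fun x => ⨆ i, |F x - g i x| := Bdd.iSup hd
  have hV : Bdd fun x => ∑ i, |F x - g i x| ^ 2 := Bdd.sum fun i => (hd i).sq
  refine sq_le_of_recursion (C := 2.4195)
    (N := fun q => rnorm (Measure.pi μ) q (lowerDev F c))
    (R := fun q => max (rnorm (Measure.pi μ) (q / 2) fun x => ∑ i, |F x - g i x| ^ 2)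
        (q * rnorm (Measure.pi μ) q (fun x => ⨆ i, |F x - g i x|) ^ 2))
    (by norm_num) (fun q => rnorm_nonneg hξ) (fun p q hp hpq => rnorm_mono_exponent hp hpq hξ)
    (fun q => (rnorm_nonneg hV).trans (le_max_left _ _))
    (fun p q hp hpq => max_le_max (rnorm_mono_exponent (by linarith) (by linarith) hV) ?_)
    ?_ (fun q hq hlt => ?_) hq
  · have h1 := rnorm_mono_exponent (μ := Measure.pi μ) (by linarith) hpq hM
    have h2 := rnorm_nonneg (μ := Measure.pi μ) (q := p) hM
    have h3 : 0 ≤ q := by linarith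
    gcongr
  · refine (rnorm_two_lowerDev_le_ref μ hF hg hind).trans ?_
    rw [rnorm_one]; exact le_max_left _ _
  · set N := rnorm (Measure.pi μ) q (lowerDev F c) with hN
    set v := rnorm (Measure.pi μ) (q / 2) fun x => ∑ i, |F x - g i x| ^ 2 with hv
    set m := rnorm (Measure.pi μ) q (fun x => ⨆ i, |F x - g i x|) with hm
    refine ⟨_, contraction_ref hq, (rnorm_lowerDev_le_of_ref μ hq hF hg hind hgF c hN hv hm).trans ?_⟩
    have hq0 : 0 < q := by linarith
    have hN0 : 0 ≤ N := rnorm_nonneg hξ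
    have hm0 : 0 ≤ m := rnorm_nonneg hM
    have hv1 : 2.4195 * q * v ≤ N ^ 2 :=
      (mul_le_mul_of_nonneg_left (le_max_left _ _) (by positivity)).trans hlt.le
    have hm1 : 2.4195 * q * (q * m ^ 2) ≤ N ^ 2 :=
      (mul_le_mul_of_nonneg_left (le_max_right _ _) (by positivity)).trans hlt.le
    have hm2 : m ≤ N * (200 / (311 * q)) := by
      refine le_of_pow_le_pow_left₀ two_ne_zero (by positivity) ?_
      rw [mul_pow, div_pow, mul_div_assoc', le_div_iff₀ (by positivity)]
      nlinarith [sq_nonneg (q * m)]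
    have hNq : N ^ q = N ^ 2 * N ^ (q - 2) := by
      rcases eq_or_lt_of_le hN0 with h | h
      · rw [← h, Real.zero_rpow (by linarith)]; simp
      · rw [← Real.rpow_natCast, ← Real.rpow_add h]; norm_num
    have w1 : (N + m) ^ (q - 2) ≤ N ^ (q - 2) * (1 + 200 / (311 * q)) ^ (q - 2) := by
      rw [← Real.mul_rpow hN0 (by positivity)]
      exact Real.rpow_le_rpow (by positivity) (by linarith) (by linarith)
    have s1 : q / 2 * v * (N + m) ^ (q - 2) ≤
        (N ^ 2 / (2 * 2.4195)) * (N ^ (q - 2) * (1 + 200 / (311 * q)) ^ (q - 2)) := by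
      refine mul_le_mul ?_ w1 (by positivity) (by positivity)
      rw [le_div_iff₀ (by norm_num)]; linarith
    have e : 1 / (2 * 2.4195) * (1 + 200 / (311 * q)) ^ (q - 2) * (N ^ 2 * N ^ (q - 2)) =
        (N ^ 2 / (2 * 2.4195)) * (N ^ (q - 2) * (1 + 200 / (311 * q)) ^ (q - 2)) := by ring
    rw [hNq, e]
    linarith

end Bounded

open Filter Topology

/-! ### Truncation and transfer to the underlying probability space -/

/-- Truncation to `[-k, k]`, shifted to be nonnegative. -/
def trunc (k : ℕ) (t : ℝ) : ℝ := max (min t k) (-k) + k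

lemma trunc_mono (k : ℕ) {s t : ℝ} (h : s ≤ t) : trunc k s ≤ trunc k t := by
  unfold trunc; gcongr

lemma measurable_trunc (k : ℕ) : Measurable (trunc k) := by unfold trunc; fun_prop

lemma trunc_nonneg (k : ℕ) (t : ℝ) : 0 ≤ trunc k t := by
  unfold trunc; linarith [le_max_right (min t k) (-(k : ℝ))]

lemma trunc_le (k : ℕ) (t : ℝ) : trunc k t ≤ 2 * k := by
  have : max (min t k) (-(k : ℝ)) ≤ k :=
    max_le (min_le_right _ _) (by linarith [Nat.cast_nonneg (α := ℝ) k])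
  unfold trunc; linarith

lemma abs_trunc_sub_le (k : ℕ) (t : ℝ) : |trunc k t - k| ≤ |t| := by
  have hk := Nat.cast_nonneg (α := ℝ) k
  unfold trunc
  rw [add_sub_cancel_right, abs_le]
  have h1 := neg_abs_le t
  have h2 := le_abs_self t
  have h3 := abs_nonneg t
  refine ⟨?_, max_le ((min_le_left _ _).trans h2) (by linarith)⟩
  rcases le_total t k with h | h
  · rw [min_eq_left h]; exact h1.trans (le_max_left _ _)
  · rw [min_eq_right h]; exact le_trans (by linarith) (le_max_left _ _)

lemma trunc_sub_eq {k : ℕ} {t : ℝ} (h : |t| ≤ k) : trunc k t - k = t := by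
  rw [abs_le] at h
  unfold trunc
  rw [min_eq_left h.2, max_eq_left h.1]; ring

lemma trunc_sub_le (k : ℕ) {s t : ℝ} (h : s ≤ t) : trunc k t - trunc k s ≤ t - s := by
  unfold trunc
  rcases le_total t k with h1 | h1 <;> rcases le_total s k with h2 | h2 <;>
  simp only [min_eq_left, min_eq_right, h1, h2] <;>
  rcases max_cases t (-(k : ℝ)) with h3 | h3 <;> rcases max_cases s (-(k : ℝ)) with h4 | h4 <;>
  rcases max_cases (k : ℝ) (-(k : ℝ)) with h5 | h5 <;> linarith

/-- Truncation is monotone and 1-Lipschitz, so the upper increments, and with them V⁺ and M, remain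
valid bounds for the truncated function. -/
lemma trunc_posPart_le (k : ℕ) (s t : ℝ) : (trunc k t - trunc k s)⁺ ≤ (t - s)⁺ := by
  rcases le_total s t with h | h
  · exact posPart_mono (trunc_sub_le k h)
  · rw [posPart_eq_zero.2 (by linarith [trunc_mono k h])]; exact posPart_nonneg _

lemma trunc_abs_le (k : ℕ) (s t : ℝ) : |trunc k t - trunc k s| ≤ |t - s| := by
  rcases le_total s t with h | h
  · rw [abs_of_nonneg (by linarith [trunc_mono k h]), abs_of_nonneg (by linarith)]
    exact trunc_sub_le k h
  · rw [abs_of_nonpos (by linarith [trunc_mono k h]), abs_of_nonpos (by linarith)]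
    linarith [trunc_sub_le k h]

lemma Bdd.trunc_comp {α : Type*} [MeasurableSpace α] {F : α → ℝ} (hF : Measurable F) (k : ℕ) :
    Bdd fun x => trunc k (F x) :=
  ⟨(measurable_trunc k).comp hF, fun _ => trunc_nonneg _ _, 2 * k, fun _ => trunc_le _ _⟩

section Limit

variable {Ω : Type*} [MeasurableSpace Ω] {P : Measure Ω} [IsProbabilityMeasure P]

/-- Bounds for truncations pass to the limit. -/
lemma eLpNorm_negPart_le {Z : Ω → ℝ} (hZ : Measurable Z) (hZi : Integrable Z P) {p K : ℝ≥0∞}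
    (h : ∀ k : ℕ, eLpNorm (lowerDev (fun ω => trunc k (Z ω)) (∫ ω, trunc k (Z ω) ∂P)) p P ≤ K) :
    eLpNorm (fun ω => (Z ω - ∫ ω', Z ω' ∂P)⁻) p P ≤ K := by
  have hev : ∀ t : ℝ, ∀ᶠ k : ℕ in atTop, trunc k t - k = t := fun t => by
    obtain ⟨m, hm⟩ := exists_nat_ge |t|
    filter_upwards [eventually_ge_atTop m] with k hk
    exact trunc_sub_eq (hm.trans (by exact_mod_cast hk))
  have hpt : ∀ t : ℝ, Tendsto (fun k : ℕ => trunc k t - k) atTop (𝓝 t) := fun t =>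
    tendsto_const_nhds.congr' ((hev t).mono fun k hk => hk.symm)
  have hint : Tendsto (fun k : ℕ => ∫ ω, (trunc k (Z ω) - k) ∂P) atTop (𝓝 (∫ ω, Z ω ∂P)) :=
    tendsto_integral_of_dominated_convergence (fun ω => |Z ω|)
      (fun k => (((measurable_trunc k).comp hZ).sub measurable_const).aestronglyMeasurable)
      hZi.abs (fun k => ae_of_all _ fun ω => abs_trunc_sub_le k _) (ae_of_all _ fun ω => hpt _)
  have hlim : ∀ ω, Tendsto
      (fun k : ℕ => lowerDev (fun ω => trunc k (Z ω)) (∫ ω, trunc k (Z ω) ∂P) ω) atTop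
      (𝓝 ((Z ω - ∫ ω', Z ω' ∂P)⁻)) := fun ω => by
    have h1 : (Z ω - ∫ ω', Z ω' ∂P)⁻ = max ((∫ ω', Z ω' ∂P) - Z ω) 0 :=
      lowerDev_eq Z (∫ ω', Z ω' ∂P) ω
    rw [h1]
    -- The shift by k in `trunc` cancels against the same shift of the mean.
    refine ((hint.sub (hpt (Z ω))).max tendsto_const_nhds).congr fun k => ?_
    rw [lowerDev_eq, integral_sub (Bdd.trunc_comp hZ k).integrable (integrable_const _)]
    simp
  refine (Lp.eLpNorm_lim_le_liminf_eLpNorm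
    (fun k => ((Bdd.trunc_comp hZ k).lowerDev _).meas.aestronglyMeasurable) _
    (ae_of_all _ hlim)).trans ?_
  refine liminf_le_of_le (by isBoundedDefault) fun b hb => ?_
  obtain ⟨k, hk⟩ := hb.exists
  exact hk.trans (h k)

lemma ofReal_le_of_sq_le {C q x v m : ℝ} (hC : 0 ≤ C) (hq : 0 ≤ q) (hx : 0 ≤ x) (hm : 0 ≤ m)
    {v' m' : ℝ≥0∞} (hv : ENNReal.ofReal v ≤ v') (hm' : ENNReal.ofReal m ≤ m')
    (h : x ^ 2 ≤ C * q * max v (q * m ^ 2)) :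
    ENNReal.ofReal x ≤
      (ENNReal.ofReal (C * q) * max v' (ENNReal.ofReal q * m' ^ 2)) ^ (1 / 2 : ℝ) := by
  have h1 : ENNReal.ofReal x = (ENNReal.ofReal (x ^ 2)) ^ (1 / 2 : ℝ) := by
    rw [ENNReal.ofReal_rpow_of_nonneg (sq_nonneg x) (by norm_num), ← Real.sqrt_eq_rpow,
      Real.sqrt_sq hx]
  rw [h1]
  refine ENNReal.rpow_le_rpow ((ENNReal.ofReal_le_ofReal h).trans ?_) (by norm_num)
  rw [ENNReal.ofReal_mul (mul_nonneg hC hq), ENNReal.ofReal_max, ENNReal.ofReal_mul hq,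
    ENNReal.ofReal_pow hm]
  gcongr

end Limit

/-! ### From product measures back to the random variables. -/

section Transfer

variable {Ω 𝒳 : Type*} [MeasurableSpace Ω] [MeasurableSpace 𝒳] {P : Measure Ω}
  [IsProbabilityMeasure P] {n : ℕ}

lemma measurePreserving_vector {X : Fin n → Ω → 𝒳} (hX : ∀ i, Measurable (X i))
    (hind : iIndepFun X P) :
    MeasurePreserving (fun ω j => X j ω) P (Measure.pi fun i => P.map (X i)) :=
  ⟨measurable_pi_lambda _ hX,
    (iIndepFun_iff_map_fun_eq_pi_map fun i => (hX i).aemeasurable).1 hind⟩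

lemma measurePreserving_copies {X X' : Fin n → Ω → 𝒳} (hX : ∀ i, Measurable (X i))
    (hX' : ∀ i, Measurable (X' i)) (hind : iIndepFun (Sum.elim X X') P)
    (hid : ∀ i, IdentDistrib (X' i) (X i) P P) :
    MeasurePreserving (fun ω => ((fun j => X j ω, fun j => X' j ω) : (Fin n → 𝒳) × (Fin n → 𝒳))) P
      ((Measure.pi fun i => P.map (X i)).prod (Measure.pi fun i => P.map (X i))) := by
  have hm : ∀ s, Measurable (Sum.elim X X' s) := by
    rintro (i | i)
    · exact hX i
    · exact hX' i
  have : ∀ s, IsProbabilityMeasure (P.map (Sum.elim X X' s)) := fun s =>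
    Measure.isProbabilityMeasure_map (hm s).aemeasurable
  have h1 : MeasurePreserving (fun ω s => Sum.elim X X' s ω) P
      (Measure.pi fun s => P.map (Sum.elim X X' s)) :=
    ⟨measurable_pi_lambda _ hm,
      (iIndepFun_iff_map_fun_eq_pi_map fun s => (hm s).aemeasurable).1 hind⟩
  have h2 := (measurePreserving_sumPiEquivProdPi fun s => P.map (Sum.elim X X' s)).comp h1
  simp only [Sum.elim_inl, Sum.elim_inr, fun i => (hid i).map_eq] at h2
  exact h2

/-- The conditional expectation of a function of two independent vectors given the first. -/
lemma condExp_eq_integral {E E' : Type*} [MeasurableSpace E] [MeasurableSpace E']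
    {ν : Measure E} {ν' : Measure E'} [IsProbabilityMeasure ν] [IsProbabilityMeasure ν']
    {X : Ω → E} {X' : Ω → E'} (h : MeasurePreserving (fun ω => (X ω, X' ω)) P (ν.prod ν'))
    (hX : Measurable X) {φ : E × E' → ℝ} (hφ : Bdd φ) :
    (fun ω => ∫ y, φ (X ω, y) ∂ν') =ᵐ[P]
      P[fun ω => φ (X ω, X' ω) | MeasurableSpace.comap X inferInstance] := by
  have hg := hφ.integral_right (μ := ν')
  have hX1 : MeasurePreserving X P ν := measurePreserving_fst.comp h
  refine ae_eq_condExp_of_forall_setIntegral_eq hX.comap_le (hφ.comp h.measurable).integrable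
    (fun s _ _ => (hg.comp hX).integrable.integrableOn) ?_ ?_
  · rintro s ⟨A, hA, rfl⟩ _
    rw [← setIntegral_map hA (f := fun x => ∫ y, φ (x, y) ∂ν') hg.meas.aestronglyMeasurable
      hX.aemeasurable, hX1.map_eq]
    have h1 : X ⁻¹' A = (fun ω => (X ω, X' ω)) ⁻¹' (A ×ˢ Set.univ) := by ext; simp
    rw [h1, ← setIntegral_map (hA.prod MeasurableSet.univ) (f := φ) hφ.meas.aestronglyMeasurable
      h.measurable.aemeasurable, h.map_eq, setIntegral_prod φ hφ.integrable.integrableOn]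
    simp
  · exact (hg.meas.comp (comap_measurable X)).aestronglyMeasurable

theorem lqNorm_negPart_le_copy {X X' : Fin n → Ω → 𝒳} {F : (Fin n → 𝒳) → ℝ} {M : Ω → ℝ}
    (hX : ∀ i, Measurable (X i)) (hX' : ∀ i, Measurable (X' i))
    (hind : iIndepFun (Sum.elim X X') P) (hid : ∀ i, IdentDistrib (X' i) (X i) P P)
    (hF : Measurable F) (hZi : Integrable (Z F X) P) (hM : Measurable M) (hM0 : ∀ᵐ ω ∂P, 0 ≤ M ω)
    (hZM : ∀ i, ∀ᵐ ω ∂P, (Z F X ω - Zcopy F X X' i ω)⁺ ≤ M ω) {q : ℝ} (hq : 2 ≤ q) :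
    lqNorm P q (fun ω => (Z F X ω - ∫ ω', Z F X ω' ∂P)⁻) ≤
      (ENNReal.ofReal (4.159 * q) * max (lqNorm P (q / 2) (Vplus P F X X'))
        (ENNReal.ofReal q * lqNorm P q M ^ 2)) ^ (1 / 2 : ℝ) := by
  have hq0 : 0 < q := by linarith
  unfold lqNorm
  -- If ‖M‖_q is infinite, so is the right side. Otherwise M lies in L², since q ≥ 2.
  by_cases hMtop : eLpNorm M (ENNReal.ofReal q) P = ∞
  · rw [hMtop]
    have h1 : ENNReal.ofReal q ≠ 0 := by simpa using hq0
    have h2 : ENNReal.ofReal (4.159 * q) ≠ 0 := by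
      simp only [ne_eq, ENNReal.ofReal_eq_zero, not_le]; positivity
    rw [ENNReal.top_pow two_ne_zero, ENNReal.mul_top h1, max_eq_right le_top,
      ENNReal.mul_top h2, ENNReal.top_rpow_of_pos (by norm_num)]
    exact le_top
  have : ∀ i, IsProbabilityMeasure (P.map (X i)) := fun i =>
    Measure.isProbabilityMeasure_map (hX i).aemeasurable
  set μ : Fin n → Measure 𝒳 := fun i => P.map (X i) with hμ
  set ν := Measure.pi μ with hν
  have hJ := measurePreserving_copies hX hX' hind hid
  set J : Ω → (Fin n → 𝒳) × (Fin n → 𝒳) := fun ω => (fun j => X j ω, fun j => X' j ω) with hJ_def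
  have hXv : Measurable fun ω j => X j ω := measurable_pi_lambda _ hX
  have hV : MeasurePreserving (fun ω j => X j ω) P ν := measurePreserving_fst.comp hJ
  have hZm : Measurable (Z F X) := hF.comp hXv
  have hYm : ∀ i, Measurable fun ω => (Z F X ω - Zcopy F X X' i ω)⁺ := fun i =>
    (hZm.sub (hF.comp ((measurable_resample i).comp hJ.measurable))).max measurable_const
  have hMmem : MemLp M (ENNReal.ofReal q) P :=
    ⟨hM.aestronglyMeasurable, lt_top_iff_ne_top.2 hMtop⟩
  -- Integrability matters: `condExp` of a non-integrable function is 0 by default, and V⁺ could not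
  -- be compared with its truncated version.
  have hYi : Integrable (fun ω => ∑ i, ((Z F X ω - Zcopy F X X' i ω)⁺) ^ 2) P := by
    refine integrable_finsetSum _ fun i _ => ?_
    have hM2 : MemLp M 2 P := hMmem.mono_exponent (by
      rw [show (2 : ℝ≥0∞) = ENNReal.ofReal 2 by simp]; exact ENNReal.ofReal_le_ofReal hq)
    refine (hM2.mono (hYm i).aestronglyMeasurable ?_).integrable_sq
    filter_upwards [hZM i, hM0] with ω h1 h2
    rw [Real.norm_eq_abs, Real.norm_eq_abs, abs_of_nonneg (posPart_nonneg _), abs_of_nonneg h2]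
    exact h1
  refine eLpNorm_negPart_le hZm hZi fun k => ?_
  set Fk : (Fin n → 𝒳) → ℝ := fun x => trunc k (F x) with hFk
  have hFb : Bdd Fk := Bdd.trunc_comp hF k
  have hup : ∀ i ω, upInc Fk i (J ω) ≤ (Z F X ω - Zcopy F X X' i ω)⁺ := fun i ω =>
    trunc_posPart_le k _ _
  have hmean : ∫ ω, trunc k (Z F X ω) ∂P = ∫ x, Fk x ∂ν := by
    rw [← hV.map_eq, integral_map hXv.aemeasurable hFb.meas.aestronglyMeasurable]
    rfl
  have h1 : eLpNorm (lowerDev (fun ω => trunc k (Z F X ω)) (∫ ω, trunc k (Z F X ω) ∂P))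
      (ENNReal.ofReal q) P = ENNReal.ofReal (rnorm ν q (lowerDev Fk (∫ x, Fk x ∂ν))) := by
    rw [hmean, ← eLpNorm_eq_rnorm hq0 (hFb.lowerDev _),
      ← eLpNorm_comp_measurePreserving (hFb.lowerDev _).meas.aestronglyMeasurable hV]
    rfl
  rw [h1]
  refine ofReal_le_of_sq_le (by norm_num) hq0.le (rnorm_nonneg (hFb.lowerDev _))
    (rnorm_nonneg hFb.maxInc) ?_ ?_ (rnorm_lowerDev_sq_le μ hFb hq)
  · rw [← eLpNorm_eq_rnorm (by linarith) (hFb.upVar μ),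
      ← eLpNorm_comp_measurePreserving (hFb.upVar μ).meas.aestronglyMeasurable hV]
    have hb : Bdd fun z => ∑ i, upInc Fk i z ^ 2 := Bdd.sum fun i => (hFb.upInc i).sq
    have hc := condExp_eq_integral (ν := ν) (ν' := ν) hJ hXv hb
    have hmono : P[fun ω => ∑ i, upInc Fk i (J ω) ^ 2 | sigmaX X] ≤ᵐ[P] Vplus P F X X' :=
      condExp_mono (hb.comp hJ.measurable).integrable hYi (ae_of_all _ fun ω =>
        Finset.sum_le_sum fun i _ =>
          pow_le_pow_left₀ ((hFb.upInc i).nonneg _) (hup i ω) 2)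
    refine eLpNorm_mono_ae_real ?_
    filter_upwards [hc, hmono] with ω e1 e2
    rw [Function.comp_apply, Real.norm_eq_abs, abs_of_nonneg ((hFb.upVar μ).nonneg _)]
    exact e1.le.trans e2
  · rw [← eLpNorm_eq_rnorm hq0 hFb.maxInc,
      ← eLpNorm_comp_measurePreserving hFb.maxInc.meas.aestronglyMeasurable hJ]
    refine eLpNorm_mono_ae_real ?_
    filter_upwards [ae_all_iff.2 hZM, hM0] with ω e1 e2
    rw [Function.comp_apply, Real.norm_eq_abs, abs_of_nonneg (hFb.maxInc.nonneg _)]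
    -- For n = 0 the supremum is 0 by default, so M ≥ 0 is needed as well.
    exact Real.iSup_le (fun i => (hup i ω).trans (e1 i)) e2

theorem lqNorm_negPart_le_loo {X : Fin n → Ω → 𝒳} {F : (Fin n → 𝒳) → ℝ}
    {G : (i : Fin n) → ({j : Fin n // j ≠ i} → 𝒳) → ℝ} {M : Ω → ℝ}
    (hX : ∀ i, Measurable (X i)) (hind : iIndepFun X P) (hF : Measurable F)
    (hG : ∀ i, Measurable (G i)) (hZi : Integrable (Z F X) P) (hM0 : ∀ᵐ ω ∂P, 0 ≤ M ω)
    (hZM : ∀ i, ∀ᵐ ω ∂P, 0 ≤ Z F X ω - Zloo G X i ω ∧ Z F X ω - Zloo G X i ω ≤ M ω) {q : ℝ}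
    (hq : 2 ≤ q) :
    lqNorm P q (fun ω => (Z F X ω - ∫ ω', Z F X ω' ∂P)⁻) ≤
      (ENNReal.ofReal (2.4195 * q) * max (lqNorm P (q / 2) (V F G X))
        (ENNReal.ofReal q * lqNorm P q M ^ 2)) ^ (1 / 2 : ℝ) := by
  have hq0 : 0 < q := by linarith
  unfold lqNorm
  have : ∀ i, IsProbabilityMeasure (P.map (X i)) := fun i =>
    Measure.isProbabilityMeasure_map (hX i).aemeasurable
  set μ : Fin n → Measure 𝒳 := fun i => P.map (X i) with hμ
  set ν := Measure.pi μ with hν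
  have hV : MeasurePreserving (fun ω j => X j ω) P ν := measurePreserving_vector hX hind
  have hXv := hV.measurable
  have hZm : Measurable (Z F X) := hF.comp hXv
  refine eLpNorm_negPart_le hZm hZi fun k => ?_
  set Fk : (Fin n → 𝒳) → ℝ := fun x => trunc k (F x) with hFk
  set g : Fin n → (Fin n → 𝒳) → ℝ := fun i x => trunc k (G i fun j => x j) with hg_def
  have hFb : Bdd Fk := Bdd.trunc_comp hF k
  have hg : ∀ i, Bdd (g i) := fun i => Bdd.trunc_comp
    ((hG i).comp (measurable_pi_lambda _ fun j => measurable_pi_apply _)) k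
  have hgind : ∀ i x y, g i (Function.update x i y) = g i x := fun i x y => by
    simp only [hg_def]
    congr 2
    funext j
    rw [Function.update_of_ne j.2]
  -- Z_i ≤ Z is assumed almost surely on Ω; being an event about X, it passes to the law of X.
  have hgF : ∀ i, ∀ᵐ x ∂ν, g i x ≤ Fk x := fun i => by
    rw [← hV.map_eq, ae_map_iff hXv.aemeasurable (measurableSet_le (hg i).meas hFb.meas)]
    filter_upwards [hZM i] with ω hω
    exact trunc_mono k (sub_nonneg.1 hω.1)
  have hdiff : ∀ i ω, |Fk (fun j => X j ω) - g i (fun j => X j ω)| ≤ |Z F X ω - Zloo G X i ω| :=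
    fun i ω => trunc_abs_le k _ _
  have hd : ∀ i, Bdd fun x => |Fk x - g i x| := fun i => by
    refine (hFb.add (hg i)).of_le (hFb.meas.sub (hg i).meas).abs (fun x => abs_nonneg _) fun x => ?_
    rw [abs_le]; constructor <;> linarith [hFb.nonneg x, (hg i).nonneg x]
  have hMb : Bdd fun x => ⨆ i, |Fk x - g i x| := Bdd.iSup hd
  have hVb : Bdd fun x => ∑ i, |Fk x - g i x| ^ 2 := Bdd.sum fun i => (hd i).sq
  have hmean : ∫ ω, trunc k (Z F X ω) ∂P = ∫ x, Fk x ∂ν := by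
    rw [← hV.map_eq, integral_map hXv.aemeasurable hFb.meas.aestronglyMeasurable]
    rfl
  have h1 : eLpNorm (lowerDev (fun ω => trunc k (Z F X ω)) (∫ ω, trunc k (Z F X ω) ∂P))
      (ENNReal.ofReal q) P = ENNReal.ofReal (rnorm ν q (lowerDev Fk (∫ x, Fk x ∂ν))) := by
    rw [hmean, ← eLpNorm_eq_rnorm hq0 (hFb.lowerDev _),
      ← eLpNorm_comp_measurePreserving (hFb.lowerDev _).meas.aestronglyMeasurable hV]
    rfl
  rw [h1]
  refine ofReal_le_of_sq_le (by norm_num) hq0.le (rnorm_nonneg (hFb.lowerDev _))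
    (rnorm_nonneg hMb) ?_ ?_ (rnorm_lowerDev_sq_le_of_ref μ hFb hg hgind hgF hq)
  · rw [← eLpNorm_eq_rnorm (by linarith) hVb,
      ← eLpNorm_comp_measurePreserving hVb.meas.aestronglyMeasurable hV]
    refine eLpNorm_mono_ae_real (ae_of_all _ fun ω => ?_)
    rw [Function.comp_apply, Real.norm_eq_abs, abs_of_nonneg (hVb.nonneg _)]
    refine Finset.sum_le_sum fun i _ => ?_
    rw [← sq_abs (Z F X ω - Zloo G X i ω)]
    exact pow_le_pow_left₀ (abs_nonneg _) (hdiff i ω) 2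
  · rw [← eLpNorm_eq_rnorm hq0 hMb,
      ← eLpNorm_comp_measurePreserving hMb.meas.aestronglyMeasurable hV]
    refine eLpNorm_mono_ae_real ?_
    filter_upwards [ae_all_iff.2 hZM, hM0] with ω e1 e2
    rw [Function.comp_apply, Real.norm_eq_abs, abs_of_nonneg (hMb.nonneg _)]
    exact Real.iSup_le (fun i => (hdiff i ω).trans
      ((abs_of_nonneg (e1 i).1).le.trans (e1 i).2)) e2

end Transfer

end MomentIneq

end

theorem theorem4 :
    ∃ C₁ C₂ : ℝ, 0 < C₁ ∧ C₁ < 4.16 ∧ 0 < C₂ ∧ C₂ < 2.42 ∧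
      (∀ (Ω : Type*) (𝒳 : Type*) [MeasurableSpace Ω] [MeasurableSpace 𝒳]
          (P : Measure Ω) [IsProbabilityMeasure P] (n : ℕ)
          (X X' : Fin n → Ω → 𝒳) (F : (Fin n → 𝒳) → ℝ) (M : Ω → ℝ),
        (∀ i, Measurable (X i)) → (∀ i, Measurable (X' i)) →
        iIndepFun (Sum.elim X X') P →
        (∀ i, IdentDistrib (X' i) (X i) P P) →
        Measurable F → Integrable (MomentIneq.Z F X) P →
        Measurable M → (∀ᵐ ω ∂P, 0 ≤ M ω) →
        (∀ i, ∀ᵐ ω ∂P, (MomentIneq.Z F X ω - MomentIneq.Zcopy F X X' i ω)⁺ ≤ M ω) →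
        ∀ q : ℝ, 2 ≤ q →
          MomentIneq.lqNorm P q
              (fun ω => (MomentIneq.Z F X ω - ∫ ω', MomentIneq.Z F X ω' ∂P)⁻) ≤
            (ENNReal.ofReal (C₁ * q) *
              max (MomentIneq.lqNorm P (q / 2) (MomentIneq.Vplus P F X X'))
                (ENNReal.ofReal q * MomentIneq.lqNorm P q M ^ 2)) ^ (1 / 2 : ℝ)) ∧
      (∀ (Ω : Type*) (𝒳 : Type*) [MeasurableSpace Ω] [MeasurableSpace 𝒳]
          (P : Measure Ω) [IsProbabilityMeasure P] (n : ℕ)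
          (X : Fin n → Ω → 𝒳) (F : (Fin n → 𝒳) → ℝ)
          (G : (i : Fin n) → ({j : Fin n // j ≠ i} → 𝒳) → ℝ) (M : Ω → ℝ),
        (∀ i, Measurable (X i)) → iIndepFun X P →
        Measurable F → (∀ i, Measurable (G i)) → Integrable (MomentIneq.Z F X) P →
        Measurable M → (∀ᵐ ω ∂P, 0 ≤ M ω) →
        (∀ i, ∀ᵐ ω ∂P, 0 ≤ MomentIneq.Z F X ω - MomentIneq.Zloo G X i ω ∧
          MomentIneq.Z F X ω - MomentIneq.Zloo G X i ω ≤ M ω) →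
        ∀ q : ℝ, 2 ≤ q →
          MomentIneq.lqNorm P q
              (fun ω => (MomentIneq.Z F X ω - ∫ ω', MomentIneq.Z F X ω' ∂P)⁻) ≤
            (ENNReal.ofReal (C₂ * q) *
              max (MomentIneq.lqNorm P (q / 2) (MomentIneq.V F G X))
                (ENNReal.ofReal q * MomentIneq.lqNorm P q M ^ 2)) ^ (1 / 2 : ℝ)) := by
  refine ⟨4.159, 2.4195, by norm_num, by norm_num, by norm_num, by norm_num, ?_, ?_⟩
  · intro Ω 𝒳 _ _ P _ n X X' F M hX hX' hind hid hF hZi hM hM0 hZM q hq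
    exact MomentIneq.lqNorm_negPart_le_copy hX hX' hind hid hF hZi hM hM0 hZM hq
  · intro Ω 𝒳 _ _ P _ n X F G M hX hind hF hG hZi _ hM0 hZM q hq
    exact MomentIneq.lqNorm_negPart_le_loo hX hind hF hG hZi hM0 hZM hq
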